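/- Let $G=(V,E)$ be a locally finite graph and $s\colon E\to\{-1,1\}$. The signed voter model on $(G,s)$ is the spin system on $\{-1,1\}^V$ with operator $$\Omega f(\eta)=\sum_{x\in V}\bigl(f(\eta^x)-f(\eta)\bigr)\,\frac1{d(x)}\sum_{y:\{x,y\}\in E}\mathbf 1\{\eta(x)\eta(y)\neq s(\{x,y\})\},$$ where $d(x)$ is the degree of $x$ and $\eta^x$ is $\eta$ with the spin at $x$ flipped; that is, the Feller process whose generator is $\Omega$ on functions depending on finitely many spins. An equilibrium is an invariant probability measure of this process. An unsatisfied cycle is a cycle along which the product of the signs of the edges is $-1$. The random walk on $G$ waits an exponential time of rate $1$ at each site and then jumps to a uniformly chosen neighbour. **Proposition.** The existence of multiple equilibria does not in general imply that there is a region $W\subset V$ such that the graph inherited by $W$ has no unsatisfied cycle and such that, from some starting point, the random walk with strictly positive probability never leaves $W$. Precisely: (1) There are a connected, locally finite graph $G=(V,E)$ and a sign function $s\colon E\to\{-1,1\}$ such that the signed voter model on $(G,s)$ has at least two equilibria, but there is no $W\subset V$ whose inherited graph has no unsatisfied cycle and for which $P^x(X(t)\in W\ \text{for all } t\ge 0)>0$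 for some $x\in V$. (2) The following graphs have these properties. Let $(n_i)_{i\ge0}$ be positive even integers with $n_i\to\infty$, and let $1\le V_0<V_1<V_2<\cdots$ be integers with $n_{V_k}\ge 2^k$ for all $k\ge 0$. Take the rooted tree in which every vertex of generation $i$ has $n_i$ children (the root being generation $0$). In each of the generations $V_0,V_1,\dots$ pair up the vertices so that the two members of each pair have the same father, and join the two members of each pair by an additional edge. Give sign $+1$ to all edges of the tree and sign $-1$ to all additional edges. -/

import Mathlib

open MeasureTheory ProbabilityTheory Filter Topology
open scoped NNReal

namespace SignedVoter

/-! ### The signed voter model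

A sign function on the edges is given as a function `s` on all unordered pairs; only its values on
the edges of the graph are ever used. -/

instance : DiscreteMeasurableSpace ℤˣ where
  forall_measurableSet t :=
    ⟨Units.val '' t, MeasurableSpace.measurableSet_top,
      Set.preimage_image_eq t Units.val_injective⟩

section Model

variable {V : Type*}

/-- Spin configurations, with the product topology and the product `σ`-algebra. -/
abbrev Config (V : Type*) : Type _ := V → ℤˣ

open Classical in
/-- The configuration `η ^ x`, which is `η` with the spin at `x` flipped. -/
noncomputable def flip (η : Config V) (x : V) : Config V :=
  Function.update η x (-η x)

open Classical in
/-- The rate at which the spin at `x` flips: the proportion of neighbours `y` of `x` with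
`η x * η y ≠ s {x, y}`. -/
noncomputable def flipRate (G : SimpleGraph V) [G.LocallyFinite] (s : Sym2 V → ℤˣ)
    (x : V) (η : Config V) : ℝ :=
  (1 / (G.degree x : ℝ)) *
    ∑ y ∈ G.neighborFinset x, if η x * η y ≠ s s(x, y) then 1 else 0

/-- The operator `Ω` of the model. It is only used on cylinder functions, where the sum over the
vertices has only finitely many nonzero terms. -/
noncomputable def operator (G : SimpleGraph V) [G.LocallyFinite] (s : Sym2 V → ℤˣ)
    (f : Config V → ℝ) (η : Config V) : ℝ :=
  ∑' x, (f (flip η x) - f η) * flipRate G s x η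

/-- A function on configurations that depends on the spins at finitely many vertices only. -/
def IsCylinder (f : Config V → ℝ) : Prop :=
  ∃ A : Finset V, DependsOn f (A : Set V)

/-- `T` is the Markov (Feller) semigroup on `C({-1, 1} ^ V)` of the spin system with operator `Ω`:
a strongly continuous, positive, unital semigroup whose generator is `Ω` on cylinder functions. -/
structure IsSemigroup (G : SimpleGraph V) [G.LocallyFinite] (s : Sym2 V → ℤˣ)
    (T : ℝ≥0 → C(Config V, ℝ) →L[ℝ] C(Config V, ℝ)) : Prop where
  zero : ∀ f, T 0 f = f
  add : ∀ t u f, T (t + u) f = T t (T u f)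
  one : ∀ t, T t 1 = 1
  nonneg : ∀ t f, 0 ≤ f → 0 ≤ T t f
  continuous : ∀ f, Continuous fun t => T t f
  generator : ∀ f : C(Config V, ℝ), IsCylinder f →
    TendstoUniformly (fun (t : ℝ≥0) η => (T t f η - f η) / (t : ℝ)) (operator G s f) (𝓝[>] 0)

/-- An equilibrium (invariant probability measure) of the semigroup `T`. -/
structure IsEquilibrium (T : ℝ≥0 → C(Config V, ℝ) →L[ℝ] C(Config V, ℝ))
    (μ : Measure (Config V)) : Prop where
  prob : IsProbabilityMeasure μ
  invariant : ∀ t f, ∫ η, T t f η ∂μ = ∫ η, f η ∂μ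

/-- The signed voter model on `G` with signs `s` has at least two equilibria. -/
def HasMultipleEquilibria (G : SimpleGraph V) [G.LocallyFinite] (s : Sym2 V → ℤˣ) : Prop :=
  ∃ T, IsSemigroup G s T ∧ ∃ μ ν, IsEquilibrium T μ ∧ IsEquilibrium T ν ∧ μ ≠ ν

/-! ### Unsatisfied cycles -/

/-- The sign of a walk: the product of the signs of the edges it traverses, with multiplicity. -/
def walkSign {G : SimpleGraph V} (s : Sym2 V → ℤˣ) {x y : V} (w : G.Walk x y) : ℤˣ :=
  (w.edges.map s).prod

/-- The graph `G` with signs `s` contains an unsatisfied cycle, i.e. a cycle of sign `-1`. -/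
def HasUnsatisfiedCycle (G : SimpleGraph V) (s : Sym2 V → ℤˣ) : Prop :=
  ∃ (x : V) (c : G.Walk x x), c.IsCycle ∧ walkSign s c = -1

/-- The region `W`, with the inherited edges and signs, contains an unsatisfied cycle. -/
def RegionHasUnsatisfiedCycle (G : SimpleGraph V) (s : Sym2 V → ℤˣ) (W : Set V) : Prop :=
  HasUnsatisfiedCycle (G.induce W) fun e => s (e.map Subtype.val)

end Model

/-! ### The random walk in continuous time -/

section Walk

variable {V : Type*} [MeasurableSpace V] [DiscreteMeasurableSpace V]

/-- The law of one jump from `x`: uniform on the neighbours (no move at an isolated vertex). -/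
noncomputable def stepLaw (G : SimpleGraph V) [G.LocallyFinite] (x : V) : Measure V :=
  open Classical in
  if h : (G.neighborFinset x).Nonempty then (PMF.uniformOfFinset _ h).toMeasure
  else Measure.dirac x

/-- The jump kernel, as a function of the path up to time `n`. -/
noncomputable def jumpKernel (G : SimpleGraph V) [G.LocallyFinite] (n : ℕ) :
    Kernel ((i : Finset.Iic n) → V) V where
  toFun p := stepLaw G (p ⟨n, Finset.mem_Iic.2 le_rfl⟩)
  measurable' := (Measurable.of_discrete (f := stepLaw G)).comp (measurable_pi_apply _)

instance (G : SimpleGraph V) [G.LocallyFinite] (n : ℕ) : IsMarkovKernel (jumpKernel G n) where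
  isProbabilityMeasure p := by
    change IsProbabilityMeasure (stepLaw G _)
    unfold stepLaw
    split_ifs <;> infer_instance

/-- The law of the sequence of sites visited by the walk from `x`. -/
noncomputable def jumpChain (G : SimpleGraph V) [G.LocallyFinite] (x : V) : Measure (ℕ → V) :=
  Kernel.traj (X := fun _ => V) (jumpKernel G) 0 fun _ => x

/-- The law of the walk from `x`: the sequence of sites visited, together with independent holding
times that are exponential of rate `1`. -/
noncomputable def walkLaw (G : SimpleGraph V) [G.LocallyFinite] (x : V) :
    Measure ((ℕ → V) × (ℕ → ℝ)) :=
  (jumpChain G x).prod (Measure.infinitePi fun _ => expMeasure 1)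

/-- The position at time `t` of the walk with sites `ω.1` and holding times `ω.2`: the number of
jumps up to time `t` is the largest `n` for which the first `n` holding times add up to at most
`t`. -/
noncomputable def position (ω : (ℕ → V) × (ℕ → ℝ)) (t : ℝ) : V :=
  ω.1 (sSup {n : ℕ | ∑ k ∈ Finset.range n, ω.2 k ≤ t})

/-- The probability that the walk from `x` never leaves `W`. -/
noncomputable def stayProb (G : SimpleGraph V) [G.LocallyFinite] (x : V) (W : Set V) : ENNReal :=
  walkLaw G x {ω | ∀ t : ℝ, 0 ≤ t → position ω t ∈ W}

end Walk

/-! ### The signed trees -/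

section Tree

/-- The vertices of generation `k` of the rooted tree in which every vertex of generation `i` has
`b i` children: a vertex of generation `k + 1` is given by its father and by its index among the
children of the father. -/
inductive Gen (b : ℕ → ℕ) : ℕ → Type
  | root : Gen b 0
  | child {k : ℕ} (g : Gen b k) (a : Fin (b k)) : Gen b (k + 1)

/-- The vertices of the tree. -/
structure Vertex (b : ℕ → ℕ) where
  generation : ℕ
  point : Gen b generation

instance (b : ℕ → ℕ) : MeasurableSpace (Vertex b) := ⊤

instance (b : ℕ → ℕ) : DiscreteMeasurableSpace (Vertex b) where
  forall_measurableSet _ := MeasurableSpace.measurableSet_top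

/-- The child with index `a` of the vertex `g` of generation `k`. -/
def child {b : ℕ → ℕ} {k : ℕ} (g : Gen b k) (a : Fin (b k)) : Vertex b := ⟨k + 1, g.child a⟩

/-- The rooted tree: edges join fathers and children. -/
def treeGraph (b : ℕ → ℕ) : SimpleGraph (Vertex b) :=
  SimpleGraph.fromRel fun x y => ∃ (k : ℕ) (g : Gen b k) (a : Fin (b k)),
    x = ⟨k, g⟩ ∧ y = child g a

/-- The additional edges: in each of the generations `L 0, L 1, …`, the children of one father are
paired up, the child of index `2 * j` with the child of index `2 * j + 1`. -/
def pairGraph (b L : ℕ → ℕ) : SimpleGraph (Vertex b) :=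
  SimpleGraph.fromRel fun x y => ∃ (k : ℕ) (g : Gen b k) (a a' : Fin (b k)),
    k + 1 ∈ Set.range L ∧ Even (a : ℕ) ∧ (a' : ℕ) = a + 1 ∧ x = child g a ∧ y = child g a'

/-- The tree with the additional edges. -/
def pairedTree (b L : ℕ → ℕ) : SimpleGraph (Vertex b) := treeGraph b ⊔ pairGraph b L

open Classical in
/-- The additional edges are negative, the edges of the tree are positive. -/
noncomputable def pairedSign (b L : ℕ → ℕ) (e : Sym2 (Vertex b)) : ℤˣ :=
  if e ∈ (pairGraph b L).edgeSet then -1 else 1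

/-- Every vertex of generation `i` has `b i` children, where `b i` is even, positive and tends to
infinity, and the generations `L 0 < L 1 < …` are so sparse that `b (L n) ≥ 2 ^ n`. -/
structure IsAdmissible (b L : ℕ → ℕ) : Prop where
  pos : ∀ i, 0 < b i
  even : ∀ i, Even (b i)
  tendsto : Tendsto b atTop atTop
  strictMono : StrictMono L
  one_le : ∀ n, 1 ≤ L n
  sparse : ∀ n, 2 ^ n ≤ b (L n)

end Tree

end SignedVoter

/-!
The signed voter model is dual to annihilating random walks that pick up the signs of the edges they
cross: in the basis of spin monomials its operator is `dualOperator`, and a move never increases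
the number of particles. Therefore the exponential series of the operator converges on spin
polynomials (`exists_norm_spinPoly_pow_le`). A minimum principle (`sub_le_partialSum`,
`le_expOperator`) makes it a contraction there, and spin polynomials are dense, so that it extends
to the Feller semigroup of the model (`isSemigroup_semigroup`). Limit points of time averages are
equilibria (`IsSemigroup.exists_isEquilibrium`).

For a single spin the dual is one random walk, and the expected spin at `x` at time `t`, started
from the configuration `1`, is the expected sign collected by the walk from `x`. It is at least
`1 - g x` for every nonnegative `g` that dominates twice the expected number of negative edges
crossed; started from `-1`, the expected spin has the opposite sign.
So there are two equilibria as soon as `g x < 1` for some `x`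
(`hasMultipleEquilibria_of_supersolution`). On the paired trees the walk drifts away from the root
and crosses an extra edge of generation `L n` with probability of order at most `2 ^ (-n)`; an
explicit radial function `g` is summed up in `exists_radial_supersolution`.

On the other hand, a region `W` without unsatisfied cycles contains at most one vertex of each pair
of children of a vertex of `W` in a generation just above a paired one. There the probability `u`
of staying in `W` is at most `3 / 4` of the supremum of `u` (`IsAdmissible.le_three_quarters`). As
`u` is subharmonic, it is dominated in each ball around the root by its values on the sphere
(`IsAdmissible.exists_generation_eq_and_le`), so the bound holds everywhere, and `u` vanishes
(`IsAdmissible.stayProb_eq_zero`).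
-/

namespace SignedVoter

/-! ### Spin monomials and the dual operator -/

section Monomials

open scoped Classical

variable {V : Type*}

/-- The spin at `x`, as a continuous real function of the configuration. -/
def spin (x : V) : C(Config V, ℝ) where
  toFun η := ((η x : ℤ) : ℝ)
  continuous_toFun :=
    (continuous_of_discreteTopology (f := fun u : ℤˣ => ((u : ℤ) : ℝ))).comp (continuous_apply x)

/-- The product of the spins over a finite set of sites. -/
noncomputable def spinProd (A : Finset V) : C(Config V, ℝ) := ∏ x ∈ A, spin x

/-- Formal linear combinations of finite sets of sites, read as functions on configurations. -/
noncomputable def spinPoly : (Finset V →₀ ℝ) →ₗ[ℝ] C(Config V, ℝ) :=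
  Finsupp.linearCombination ℝ spinProd

/-- The set `A` after the particle at `x` has jumped to `y`, where two particles at the same site
annihilate each other. -/
noncomputable def moveParticle (A : Finset V) (x y : V) : Finset V :=
  if y ∈ A.erase x then (A.erase x).erase y else insert y (A.erase x)

/-- The operator of the model in the basis of spin monomials. It is the generator of
annihilating random walks, each of which picks up the signs of the edges that it crosses. -/
noncomputable def dualOperator (G : SimpleGraph V) [G.LocallyFinite] (s : Sym2 V → ℤˣ) :
    Module.End ℝ (Finset V →₀ ℝ) :=
  Finsupp.linearCombination ℝ fun A : Finset V => ∑ x ∈ A, (1 / (G.degree x : ℝ)) •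
    ∑ y ∈ G.neighborFinset x,
      (((s s(x, y) : ℤ) : ℝ) • Finsupp.single (moveParticle A x y) (1 : ℝ) - Finsupp.single A 1)

@[simp] lemma spin_apply (x : V) (η : Config V) : spin x η = ((η x : ℤ) : ℝ) := rfl

lemma spinProd_apply (A : Finset V) (η : Config V) : spinProd A η = ∏ x ∈ A, ((η x : ℤ) : ℝ) := by
  simp [spinProd, ContinuousMap.prod_apply]

@[simp] lemma spinPoly_single (A : Finset V) (c : ℝ) :
    spinPoly (Finsupp.single A c) = c • spinProd A := by
  simp [spinPoly]

lemma abs_unit (u : ℤˣ) : |((u : ℤ) : ℝ)| = 1 := by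
  rcases Int.units_eq_one_or u with rfl | rfl <;> simp

lemma unit_mul_self (u : ℤˣ) : ((u : ℤ) : ℝ) * ((u : ℤ) : ℝ) = 1 := by
  rcases Int.units_eq_one_or u with rfl | rfl <;> simp

lemma norm_spinProd_le (A : Finset V) : ‖spinProd A‖ ≤ 1 := by
  refine (ContinuousMap.norm_le _ zero_le_one).2 fun η => ?_
  rw [spinProd_apply, Real.norm_eq_abs, Finset.abs_prod]
  simp [abs_unit]

lemma flip_self (η : Config V) (x : V) : flip η x x = -η x := by simp [flip]

lemma flip_of_ne (η : Config V) {x y : V} (h : y ≠ x) : flip η x y = η y := by simp [flip, h]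

lemma spinProd_flip_of_mem {A : Finset V} {x : V} (h : x ∈ A) (η : Config V) :
    spinProd A (flip η x) = -spinProd A η := by
  rw [spinProd_apply, spinProd_apply, ← Finset.mul_prod_erase A _ h, ← Finset.mul_prod_erase A _ h,
    flip_self, Finset.prod_congr rfl fun y hy => by rw [flip_of_ne η (Finset.ne_of_mem_erase hy)]]
  simp

lemma spinProd_flip_of_notMem {A : Finset V} {x : V} (h : x ∉ A) (η : Config V) :
    spinProd A (flip η x) = spinProd A η := by
  rw [spinProd_apply, spinProd_apply]
  exact Finset.prod_congr rfl fun y hy => by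
    rw [flip_of_ne η (ne_of_mem_of_not_mem hy h)]

lemma spinProd_moveParticle {A : Finset V} {x : V} (h : x ∈ A) (y : V) (η : Config V) :
    spinProd (moveParticle A x y) η = spinProd A η * (((η x : ℤ) : ℝ) * ((η y : ℤ) : ℝ)) := by
  rw [spinProd_apply, spinProd_apply, ← Finset.mul_prod_erase A _ h, moveParticle]
  have hx := unit_mul_self (η x)
  have hy := unit_mul_self (η y)
  split_ifs with hmem
  · rw [← Finset.mul_prod_erase (A.erase x) _ hmem]
    linear_combination (-(∏ z ∈ (A.erase x).erase y, ((η z : ℤ) : ℝ))) *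
      (((η y : ℤ) : ℝ) * ((η y : ℤ) : ℝ) * hx + hy)
  · rw [Finset.prod_insert hmem]
    linear_combination (-(∏ z ∈ A.erase x, ((η z : ℤ) : ℝ)) * ((η y : ℤ) : ℝ)) * hx

lemma card_moveParticle_le {A : Finset V} {x : V} (h : x ∈ A) (y : V) :
    (moveParticle A x y).card ≤ A.card := by
  have h1 : (A.erase x).card + 1 = A.card := Finset.card_erase_add_one h
  unfold moveParticle
  split_ifs with hmem
  · exact (Finset.card_le_card (Finset.erase_subset _ _)).trans (by omega)
  · rw [Finset.card_insert_of_notMem hmem, h1]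

variable (G : SimpleGraph V) [G.LocallyFinite] (s : Sym2 V → ℤˣ)

lemma dualOperator_single (A : Finset V) (c : ℝ) :
    dualOperator G s (Finsupp.single A c) = c • ∑ x ∈ A, (1 / (G.degree x : ℝ)) •
      ∑ y ∈ G.neighborFinset x, (((s s(x, y) : ℤ) : ℝ) •
        Finsupp.single (moveParticle A x y) (1 : ℝ) - Finsupp.single A 1) := by
  simp [dualOperator]

lemma flipRate_nonneg (x : V) (η : Config V) : 0 ≤ flipRate G s x η :=
  mul_nonneg (by positivity) (Finset.sum_nonneg fun y _ => by split_ifs <;> simp)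

/-- The operator of the model acts on spin polynomials as the dual operator. -/
lemma hasSum_operator (a : Finset V →₀ ℝ) (η : Config V) :
    HasSum (fun x => (spinPoly a (flip η x) - spinPoly a η) * flipRate G s x η)
      (spinPoly (dualOperator G s a) η) := by
  induction a using Finsupp.induction_linear with
  | zero => simp
  | add a b ha hb =>
    simp only [map_add, ContinuousMap.add_apply]
    convert ha.add hb using 2
    ring
  | single A c =>
    have key : spinPoly (dualOperator G s (Finsupp.single A c)) η = ∑ x ∈ A,
        (spinPoly (Finsupp.single A c) (flip η x) - spinPoly (Finsupp.single A c) η) *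
          flipRate G s x η := by
      rw [dualOperator_single]
      simp only [map_smul, map_sum, map_sub, spinPoly_single, one_smul, ContinuousMap.smul_apply,
        ContinuousMap.sum_apply, ContinuousMap.sub_apply, smul_eq_mul, Finset.mul_sum]
      refine Finset.sum_congr rfl fun x hx => ?_
      rw [spinProd_flip_of_mem hx, flipRate, Finset.mul_sum, Finset.mul_sum]
      refine Finset.sum_congr rfl fun y _ => ?_
      rw [spinProd_moveParticle hx]
      rcases Int.units_eq_one_or (η x) with h1 | h1 <;>
        rcases Int.units_eq_one_or (η y) with h2 | h2 <;>
        rcases Int.units_eq_one_or (s s(x, y)) with h3 | h3 <;> simp [h1, h2, h3] <;> ring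
    rw [key]
    refine hasSum_sum_of_ne_finset_zero fun x hx => ?_
    simp [spinProd_flip_of_notMem hx]

lemma operator_spinPoly (a : Finset V →₀ ℝ) :
    operator G s (spinPoly a) = spinPoly (dualOperator G s a) :=
  funext fun η => (hasSum_operator G s a η).tsum_eq

/-- The minimum principle for the operator of the model. -/
lemma spinPoly_dualOperator_nonneg_of_isMin {a : Finset V →₀ ℝ} {η : Config V}
    (h : ∀ ξ, spinPoly a η ≤ spinPoly a ξ) : 0 ≤ spinPoly (dualOperator G s a) η :=
  (hasSum_operator G s a η).nonneg fun x =>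
    mul_nonneg (sub_nonneg.2 (h _)) (flipRate_nonneg G s x η)

lemma norm_spinPoly_pow_single_le (n : ℕ) : ∀ {A : Finset V} {k : ℕ}, A.card ≤ k →
    ‖spinPoly ((dualOperator G s ^ n) (Finsupp.single A 1))‖ ≤ (2 * k : ℝ) ^ n := by
  induction n with
  | zero =>
    intro A k _
    simpa using norm_spinProd_le A
  | succ n ih =>
    intro A k hA
    rw [pow_succ, Module.End.mul_apply, dualOperator_single, one_smul]
    simp only [map_sum, map_smul, map_sub]
    have hx : ∀ x ∈ A, ‖(1 / (G.degree x : ℝ)) • ∑ y ∈ G.neighborFinset x,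
        (((s s(x, y) : ℤ) : ℝ) • spinPoly ((dualOperator G s ^ n)
          (Finsupp.single (moveParticle A x y) (1 : ℝ))) -
          spinPoly ((dualOperator G s ^ n) (Finsupp.single A 1)))‖ ≤ 2 * (2 * k : ℝ) ^ n := by
      intro x hx
      rw [norm_smul]
      have hsum : ‖∑ y ∈ G.neighborFinset x, (((s s(x, y) : ℤ) : ℝ) •
          spinPoly ((dualOperator G s ^ n) (Finsupp.single (moveParticle A x y) (1 : ℝ))) -
          spinPoly ((dualOperator G s ^ n) (Finsupp.single A 1)))‖ ≤
          G.degree x * (2 * (2 * k : ℝ) ^ n) := by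
        refine (norm_sum_le _ _).trans ?_
        rw [← G.card_neighborFinset_eq_degree, ← nsmul_eq_mul]
        refine Finset.sum_le_card_nsmul _ _ _ fun y _ => (norm_sub_le _ _).trans ?_
        rw [norm_smul, Real.norm_eq_abs, abs_unit, one_mul, two_mul]
        exact add_le_add (ih ((card_moveParticle_le hx y).trans hA)) (ih hA)
      rcases Nat.eq_zero_or_pos (G.degree x) with h0 | h0
      · simp only [h0, Nat.cast_zero, div_zero, norm_zero, zero_mul]
        positivity
      · have h0' : (0 : ℝ) < G.degree x := by exact_mod_cast h0
        rw [Real.norm_of_nonneg (by positivity), one_div, inv_mul_le_iff₀ h0']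
        exact hsum
    refine (norm_sum_le _ _).trans ((Finset.sum_le_card_nsmul _ _ _ hx).trans ?_)
    rw [nsmul_eq_mul, pow_succ]
    have : (A.card : ℝ) ≤ k := by exact_mod_cast hA
    calc (A.card : ℝ) * (2 * (2 * k : ℝ) ^ n) ≤ k * (2 * (2 * k : ℝ) ^ n) := by gcongr
      _ = _ := by ring

/-- The powers of the dual operator grow at most geometrically on every spin polynomial: a move
does not increase the number of particles. -/
lemma exists_norm_spinPoly_pow_le (a : Finset V →₀ ℝ) : ∃ C K : ℝ, 0 ≤ C ∧ 0 ≤ K ∧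
    ∀ n, ‖spinPoly ((dualOperator G s ^ n) a)‖ ≤ C * K ^ n := by
  induction a using Finsupp.induction_linear with
  | zero => exact ⟨0, 0, le_rfl, le_rfl, fun n => by simp⟩
  | add a b ha hb =>
    obtain ⟨C, K, hC, hK, h⟩ := ha
    obtain ⟨C', K', hC', hK', h'⟩ := hb
    refine ⟨C + C', max K K', by positivity, le_max_of_le_left hK, fun n => ?_⟩
    rw [map_add, map_add, add_mul]
    refine (norm_add_le _ _).trans (add_le_add ((h n).trans ?_) ((h' n).trans ?_))
    · gcongr; exact le_max_left _ _
    · gcongr; exact le_max_right _ _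
  | single A c =>
    refine ⟨|c|, 2 * A.card, abs_nonneg c, by positivity, fun n => ?_⟩
    have : Finsupp.single A c = c • Finsupp.single A (1 : ℝ) := by simp
    rw [this, map_smul, map_smul, norm_smul, Real.norm_eq_abs]
    gcongr
    exact norm_spinPoly_pow_single_le G s n le_rfl

end Monomials

/-! ### Exponential series -/

section ExpSeries

variable {E : Type*} [NormedAddCommGroup E] [NormedSpace ℝ E]

lemma summable_norm_expSeries {v : ℕ → E} {C K : ℝ} (hv : ∀ n, ‖v n‖ ≤ C * K ^ n) (t : ℝ) :
    Summable fun n => ‖(t ^ n / n.factorial) • v n‖ := by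
  refine Summable.of_nonneg_of_le (fun _ => norm_nonneg _) (fun n => ?_)
    ((Real.summable_pow_div_factorial (|t| * K)).mul_left C)
  rw [norm_smul, norm_div, norm_pow, Real.norm_eq_abs, Real.norm_eq_abs, Nat.abs_cast]
  calc |t| ^ n / n.factorial * ‖v n‖ ≤ |t| ^ n / n.factorial * (C * K ^ n) := by
        gcongr; exact hv n
    _ = C * ((|t| * K) ^ n / n.factorial) := by rw [mul_pow]; ring

lemma summable_expSeries [CompleteSpace E] {v : ℕ → E} {C K : ℝ}
    (hv : ∀ n, ‖v n‖ ≤ C * K ^ n) (t : ℝ) : Summable fun n => (t ^ n / n.factorial) • v n :=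
  (summable_norm_expSeries hv t).of_norm

/-- The binomial theorem for the terms of two exponential series. -/
lemma sum_antidiagonal_expSeries (v : ℕ → E) (t u : ℝ) (n : ℕ) :
    ∑ p ∈ Finset.HasAntidiagonal.antidiagonal n, (u ^ p.1 / p.1.factorial) •
      (t ^ p.2 / p.2.factorial) • v (p.1 + p.2) = ((u + t) ^ n / n.factorial) • v n := by
  have h : ∀ p ∈ Finset.HasAntidiagonal.antidiagonal n, (u ^ p.1 / p.1.factorial) •
      (t ^ p.2 / p.2.factorial) • v (p.1 + p.2) =
      ((1 / n.factorial) * (u ^ p.1 * t ^ p.2 * (n.choose p.1))) • v n := by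
    intro p hp
    rw [Finset.HasAntidiagonal.mem_antidiagonal] at hp
    subst hp
    rw [smul_smul]
    congr 1
    have h2 : ((p.1 + p.2).choose p.1 : ℝ) * p.1.factorial * p.2.factorial =
      (p.1 + p.2).factorial := by
      rw [Nat.choose_symm_add]
      exact_mod_cast Nat.add_choose_mul_factorial_mul_factorial p.1 p.2
    have h3 : (p.1.factorial : ℝ) ≠ 0 := by positivity
    have h4 : (p.2.factorial : ℝ) ≠ 0 := by positivity
    have h5 : ((p.1 + p.2).factorial : ℝ) ≠ 0 := by positivity
    field_simp
    rw [← h2]; ring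
  rw [Finset.sum_congr rfl h, ← Finset.sum_smul, ← Finset.mul_sum,
    Finset.Nat.sum_antidiagonal_eq_sum_range_succ_mk, add_pow]
  congr 1
  rw [one_div, inv_mul_eq_div]

/-- The semigroup property of exponential series. -/
lemma tsum_tsum_expSeries [CompleteSpace E] {v : ℕ → E} {C K : ℝ} (hK : 0 ≤ K)
    (hv : ∀ n, ‖v n‖ ≤ C * K ^ n) {t u : ℝ} (ht : 0 ≤ t) (hu : 0 ≤ u) :
    ∑' m : ℕ, (u ^ m / m.factorial) • ∑' n : ℕ, (t ^ n / n.factorial) • v (m + n) =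
      ∑' n : ℕ, ((u + t) ^ n / n.factorial) • v n := by
  set f : ℕ × ℕ → E := fun p =>
    (u ^ p.1 / p.1.factorial) • (t ^ p.2 / p.2.factorial) • v (p.1 + p.2) with hf
  have hsum : Summable f := by
    have hC : 0 ≤ C := by simpa using (norm_nonneg _).trans (hv 0)
    have h := (Real.summable_pow_div_factorial (u * K)).norm.mul_norm
      (Real.summable_pow_div_factorial (t * K)).norm
    refine Summable.of_norm_bounded (h.mul_left C) fun p => ?_
    have hv' := hv (p.1 + p.2)
    simp only [hf, norm_smul, norm_div, norm_pow, norm_mul, Real.norm_eq_abs, Nat.abs_cast,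
      abs_of_nonneg ht, abs_of_nonneg hu, abs_of_nonneg hK]
    calc u ^ p.1 / p.1.factorial * (t ^ p.2 / p.2.factorial * ‖v (p.1 + p.2)‖)
        ≤ u ^ p.1 / p.1.factorial * (t ^ p.2 / p.2.factorial * (C * K ^ (p.1 + p.2))) := by
          gcongr
      _ = C * ((u * K) ^ p.1 / p.1.factorial * ((t * K) ^ p.2 / p.2.factorial)) := by
          rw [mul_pow, mul_pow, pow_add]; ring
  have h1 : ∑' p, f p = ∑' m : ℕ, (u ^ m / m.factorial) •
      ∑' n : ℕ, (t ^ n / n.factorial) • v (m + n) := by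
    rw [hsum.tsum_prod]
    congr 1 with m
    rw [← Summable.tsum_const_smul]
    refine summable_expSeries (C := C * K ^ m) (K := K) (fun n => ?_) t
    rw [mul_assoc, ← pow_add]; exact hv _
  rw [← h1, ← Finset.HasAntidiagonal.sigmaAntidiagonalEquivProd.tsum_eq f,
    Summable.tsum_sigma' (f := fun c => f (Finset.HasAntidiagonal.sigmaAntidiagonalEquivProd c))
      (fun n => (hasSum_fintype _).summable)
      (hsum.comp_injective Finset.HasAntidiagonal.sigmaAntidiagonalEquivProd.injective)]
  congr 1 with n
  rw [tsum_fintype, ← sum_antidiagonal_expSeries]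
  exact Finset.sum_coe_sort _ f

lemma continuous_expSeries [CompleteSpace E] {v : ℕ → E} {C K : ℝ}
    (hv : ∀ n, ‖v n‖ ≤ C * K ^ n) :
    Continuous fun t : ℝ => ∑' n : ℕ, (t ^ n / n.factorial) • v n := by
  rw [continuous_iff_continuousAt]
  intro t
  have hC : 0 ≤ C := by simpa using (norm_nonneg _).trans (hv 0)
  have h : ContinuousOn (fun t : ℝ => ∑' n : ℕ, (t ^ n / n.factorial) • v n)
      (Metric.ball 0 (|t| + 1)) := by
    have hf : ∀ n : ℕ, ContinuousOn (fun x : ℝ => (x ^ n / n.factorial) • v n)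
        (Metric.ball 0 (|t| + 1)) := fun n => by fun_prop
    have hu := (Real.summable_pow_div_factorial ((|t| + 1) * K)).mul_left C
    refine continuousOn_tsum hf hu fun n x hx => ?_
    rw [mem_ball_zero_iff, Real.norm_eq_abs] at hx
    rw [norm_smul, norm_div, norm_pow, Real.norm_eq_abs, Real.norm_eq_abs, Nat.abs_cast]
    calc |x| ^ n / n.factorial * ‖v n‖ ≤ (|t| + 1) ^ n / n.factorial * (C * K ^ n) := by
          gcongr; exact hv n
      _ = C * (((|t| + 1) * K) ^ n / n.factorial) := by rw [mul_pow]; ring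
  exact h.continuousAt (Metric.isOpen_ball.mem_nhds (by simp))

/-- The first-order expansion of an exponential series at time `0`. -/
lemma norm_expSeries_sub_le [CompleteSpace E] {v : ℕ → E} {C K : ℝ}
    (hv : ∀ n, ‖v n‖ ≤ C * K ^ n) :
    ∃ D, ∀ t : ℝ, 0 ≤ t → t ≤ 1 →
      ‖∑' n : ℕ, (t ^ n / n.factorial) • v n - v 0 - t • v 1‖ ≤ D * t ^ 2 := by
  have hC : 0 ≤ C := by simpa using (norm_nonneg _).trans (hv 0)
  have hs : Summable fun n : ℕ => C * (K ^ (n + 2) / (n + 2).factorial) :=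
    ((summable_nat_add_iff 2).2 (Real.summable_pow_div_factorial K)).mul_left C
  refine ⟨∑' n : ℕ, C * (K ^ (n + 2) / (n + 2).factorial), fun t ht ht1 => ?_⟩
  have hsum := summable_expSeries hv t
  rw [← hsum.sum_add_tsum_nat_add 2]
  simp only [Finset.sum_range_succ, Finset.sum_range_zero, pow_zero, Nat.factorial, pow_one]
  have : ∀ w : E, 0 + ((1 : ℝ) / ((1 : ℕ) : ℝ)) • v 0 + (t / (((0 + 1) * 1 : ℕ) : ℝ)) • v 1 + w -
      v 0 - t • v 1 = w := by
    intro w; simp; abel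
  rw [this]
  refine (tsum_of_norm_bounded (hs.mul_right (t ^ 2)).hasSum fun n => ?_).trans_eq
    tsum_mul_right
  rw [norm_smul, norm_div, norm_pow, Real.norm_of_nonneg ht]
  have h1 : t ^ (n + 2) ≤ t ^ 2 := pow_le_pow_of_le_one ht ht1 (by omega)
  have h2 := hv (n + 2)
  change t ^ (n + 2) / ‖((n + 2).factorial : ℝ)‖ * _ ≤ _
  rw [Real.norm_of_nonneg (by positivity : (0 : ℝ) ≤ ((n + 2).factorial : ℝ))]
  calc t ^ (n + 2) / (n + 2).factorial * ‖v (n + 2)‖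
      ≤ t ^ 2 / (n + 2).factorial * (C * K ^ (n + 2)) := by gcongr
    _ = _ := by ring

lemma hasDerivAt_sum_expSeries (v : ℕ → ℝ) (n : ℕ) (t : ℝ) :
    HasDerivAt (fun t : ℝ => ∑ k ∈ Finset.range (n + 1), t ^ k / k.factorial * v k)
      (∑ k ∈ Finset.range n, t ^ k / k.factorial * v (k + 1)) t := by
  induction n with
  | zero => simpa using hasDerivAt_const t (v 0)
  | succ n ih =>
    simp_rw [Finset.sum_range_succ _ (n + 1)]
    rw [Finset.sum_range_succ _ n]
    refine ih.add (HasDerivAt.mul_const ?_ _)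
    convert (hasDerivAt_pow (n + 1) t).div_const ((n + 1).factorial : ℝ) using 1
    rw [Nat.factorial_succ]
    have : (n.factorial : ℝ) ≠ 0 := by positivity
    push_cast
    field_simp

end ExpSeries

/-! ### The semigroup on spin polynomials -/

section PolySemigroup

variable {V : Type*} (G : SimpleGraph V) [G.LocallyFinite] (s : Sym2 V → ℤˣ)

/-- The exponential series of the operator of the model at time `t`, on spin polynomials. -/
noncomputable def expOperator (t : ℝ) : (Finset V →₀ ℝ) →ₗ[ℝ] C(Config V, ℝ) where
  toFun a := ∑' n : ℕ, (t ^ n / n.factorial) • spinPoly ((dualOperator G s ^ n) a)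
  map_add' a b := by
    obtain ⟨C, K, -, -, h⟩ := exists_norm_spinPoly_pow_le G s a
    obtain ⟨C', K', -, -, h'⟩ := exists_norm_spinPoly_pow_le G s b
    simp only [map_add, smul_add]
    exact (summable_expSeries h t).tsum_add (summable_expSeries h' t)
  map_smul' c a := by
    obtain ⟨C, K, -, -, h⟩ := exists_norm_spinPoly_pow_le G s a
    simp only [map_smul, RingHom.id_apply]
    rw [← (summable_expSeries h t).tsum_const_smul c]
    exact tsum_congr fun n => smul_comm _ _ _

lemma expOperator_apply (t : ℝ) (a : Finset V →₀ ℝ) : expOperator G s t a =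
    ∑' n : ℕ, (t ^ n / n.factorial) • spinPoly ((dualOperator G s ^ n) a) := rfl

lemma expOperator_eq_tsum_eval (t : ℝ) (a : Finset V →₀ ℝ) (η : Config V) :
    expOperator G s t a η =
      ∑' n : ℕ, t ^ n / n.factorial * spinPoly ((dualOperator G s ^ n) a) η := by
  obtain ⟨C, K, -, -, h⟩ := exists_norm_spinPoly_pow_le G s a
  exact (ContinuousMap.evalCLM ℝ η).map_tsum (summable_expSeries h t)

/-- A lower bound for a partial sum of the exponential series, up to the first neglected term. If
the minimum over `[0, t]` and all configurations, after a linear correction in time, were attained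
at a positive time, the time derivative there would contradict the minimum principle. -/
lemma sub_le_partialSum (a : Finset V →₀ ℝ) {c t : ℝ} (ht : 0 < t) (hc : ∀ η, c ≤ spinPoly a η)
    (n : ℕ) (η : Config V) {δ : ℝ} (hδ : 0 < δ) :
    c - (t ^ n / n.factorial * ‖spinPoly ((dualOperator G s ^ (n + 1)) a)‖ + δ) * t ≤
      ∑ k ∈ Finset.range (n + 1),
        t ^ k / k.factorial * spinPoly ((dualOperator G s ^ k) a) η := by
  set v : ℕ → C(Config V, ℝ) := fun k => spinPoly ((dualOperator G s ^ k) a) with hv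
  set r : ℝ := t ^ n / n.factorial * ‖v (n + 1)‖ + δ with hr
  set p : ℝ → Config V → ℝ := fun u ξ => ∑ k ∈ Finset.range (n + 1), u ^ k / k.factorial * v k ξ
    with hp
  have hcont : Continuous fun q : ℝ × Config V => p q.1 q.2 + r * q.1 := by
    refine Continuous.add (continuous_finsetSum _ fun k _ => ?_) (by fun_prop)
    exact ((continuous_fst.pow k).div_const _).mul ((v k).continuous.comp continuous_snd)
  obtain ⟨⟨u, ξ⟩, hmem, hmin⟩ := ((isCompact_Icc (a := (0 : ℝ)) (b := t)).prod
    (isCompact_univ (X := Config V))).exists_isMinOn ⟨(0, η), by simp [ht.le]⟩ hcont.continuousOn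
  have hmin' : ∀ u' ∈ Set.Icc 0 t, ∀ ξ', p u ξ + r * u ≤ p u' ξ' + r * u' := fun u' hu' ξ' =>
    hmin (a := (u', ξ')) ⟨hu', trivial⟩
  have hu : u ∈ Set.Icc 0 t := hmem.1
  rcases hu.1.eq_or_lt with h0 | h0
  · have h1 := hmin' t ⟨ht.le, le_rfl⟩ η
    have h2 : p u ξ = spinPoly a ξ := by
      rw [← h0, hp]
      simp only [Finset.sum_range_succ', ne_eq, Nat.add_eq_zero_iff, one_ne_zero, and_false,
        not_false_eq_true, zero_pow, zero_div, zero_mul, Finset.sum_const_zero, pow_zero,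
        Nat.factorial_zero, Nat.cast_one, div_one, one_mul, zero_add]
      simp [hv]
    have h3 := hc ξ
    rw [h2, ← h0, mul_zero, add_zero] at h1
    change c - r * t ≤ p t η
    linarith
  · exfalso
    set b : Finset V →₀ ℝ :=
      ∑ k ∈ Finset.range (n + 1), (u ^ k / k.factorial) • (dualOperator G s ^ k) a with hb
    have hpb : ∀ ξ', p u ξ' = spinPoly b ξ' := by
      intro ξ'
      simp [hp, hb, hv, ContinuousMap.sum_apply, map_sum]
    have hb_min : 0 ≤ spinPoly (dualOperator G s b) ξ := by
      refine spinPoly_dualOperator_nonneg_of_isMin G s fun ξ' => ?_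
      rw [← hpb, ← hpb]
      linarith [hmin' u hu ξ']
    have hLb : spinPoly (dualOperator G s b) ξ =
        ∑ k ∈ Finset.range (n + 1), u ^ k / k.factorial * v (k + 1) ξ := by
      simp only [hb, map_sum, map_smul, ContinuousMap.sum_apply, ContinuousMap.smul_apply,
        smul_eq_mul, hv, pow_succ', Module.End.mul_apply]
    rw [hLb, Finset.sum_range_succ] at hb_min
    have hlast : u ^ n / n.factorial * v (n + 1) ξ ≤ t ^ n / n.factorial * ‖v (n + 1)‖ := by
      have h1 : v (n + 1) ξ ≤ ‖v (n + 1)‖ := (le_abs_self _).trans ((v (n + 1)).norm_coe_le_norm ξ)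
      have h2 : u ^ n ≤ t ^ n := pow_le_pow_left₀ hu.1 hu.2 n
      calc u ^ n / n.factorial * v (n + 1) ξ ≤ u ^ n / n.factorial * ‖v (n + 1)‖ := by
            have := hu.1
            gcongr
        _ ≤ _ := by gcongr
    have hder := ((hasDerivAt_sum_expSeries (fun k => v k ξ) n u).add
      ((hasDerivAt_id u).const_mul r)).hasDerivWithinAt (s := Set.Iio u)
    rw [hasDerivWithinAt_iff_tendsto_slope' (by simp)] at hder
    have hpos := hder.eventually (lt_mem_nhds (a := 0) (by linarith))
    obtain ⟨u', hslope, hu'⟩ := (hpos.and (Ioo_mem_nhdsLT h0)).exists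
    have hle := hmin' u' ⟨hu'.1.le, hu'.2.le.trans hu.2⟩ ξ
    rw [slope_def_field] at hslope
    refine absurd hslope (not_lt.2 (div_nonpos_of_nonneg_of_nonpos ?_ (by linarith [hu'.2])))
    simpa [sub_nonneg, hp] using hle

/-- Positivity of the exponential of the operator. -/
lemma le_expOperator (a : Finset V →₀ ℝ) {c t : ℝ} (ht : 0 ≤ t) (hc : ∀ η, c ≤ spinPoly a η)
    (η : Config V) : c ≤ expOperator G s t a η := by
  obtain ⟨C, K, hC, hK, h⟩ := exists_norm_spinPoly_pow_le G s a
  have hsum : HasSum (fun n : ℕ => t ^ n / n.factorial * spinPoly ((dualOperator G s ^ n) a) η)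
      (expOperator G s t a η) :=
    (ContinuousMap.evalCLM ℝ η).hasSum (summable_expSeries h t).hasSum
  rcases ht.eq_or_lt with rfl | ht
  · rw [← hsum.tsum_eq, tsum_eq_single 0 (by intro n hn; simp [hn])]
    simpa using hc η
  have herr : Tendsto (fun n : ℕ => t ^ n / n.factorial *
      ‖spinPoly ((dualOperator G s ^ (n + 1)) a)‖) atTop (𝓝 0) := by
    have h1 : ∀ n, ‖spinPoly ((dualOperator G s ^ (n + 1)) a)‖ ≤ (C * K) * K ^ n := fun n => by
      rw [mul_assoc, ← pow_succ']; exact h _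
    have h2 := (summable_norm_expSeries h1 t).tendsto_atTop_zero
    refine h2.congr fun n => ?_
    rw [norm_smul, Real.norm_of_nonneg (by positivity)]
  refine le_of_forall_pos_le_add fun ε hε => ?_
  have hlim : Tendsto (fun n : ℕ => c - (t ^ n / n.factorial *
      ‖spinPoly ((dualOperator G s ^ (n + 1)) a)‖ + ε / t) * t) atTop
      (𝓝 (c - (0 + ε / t) * t)) := ((herr.add_const _).mul_const _).const_sub _
  have hle := le_of_tendsto_of_tendsto' hlim
    (hsum.tendsto_sum_nat.comp (tendsto_add_atTop_nat 1))
    fun n => sub_le_partialSum G s a ht hc n η (div_pos hε ht)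
  rw [zero_add, div_mul_cancel₀ _ ht.ne'] at hle
  linarith

lemma norm_expOperator_le {t : ℝ} (ht : 0 ≤ t) (a : Finset V →₀ ℝ) :
    ‖expOperator G s t a‖ ≤ 1 * ‖spinPoly a‖ := by
  rw [one_mul]
  refine (ContinuousMap.norm_le _ (norm_nonneg _)).2 fun η => abs_le.2 ⟨?_, ?_⟩
  · exact le_expOperator G s a ht (fun ξ => (abs_le.1 ((spinPoly a).norm_coe_le_norm ξ)).1) η
  · have := le_expOperator G s (-a) (c := -‖spinPoly a‖) ht (fun ξ => by
      rw [map_neg, ContinuousMap.neg_apply]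
      exact neg_le_neg (abs_le.1 ((spinPoly a).norm_coe_le_norm ξ)).2) η
    rw [map_neg, ContinuousMap.neg_apply] at this
    linarith

end PolySemigroup

/-! ### Density of the spin polynomials -/

section Density

variable {V : Type*}

/-- Every function of finitely many spins is a spin polynomial. -/
lemma mem_range_spinPoly_of_dependsOn (A : Finset V) : ∀ f : C(Config V, ℝ),
    DependsOn f (A : Set V) → ∃ a : Finset V →₀ ℝ, (∀ B ∈ a.support, B ⊆ A) ∧ spinPoly a = f := by
  classical
  induction A using Finset.induction_on with
  | empty =>
    intro f hf
    refine ⟨Finsupp.single ∅ (f 1), fun B hB => ?_, ?_⟩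
    · rw [Finset.mem_singleton.1 (Finsupp.support_single_subset hB)]
    · ext η
      simp only [spinPoly_single, ContinuousMap.smul_apply, spinProd_apply, Finset.prod_empty,
        smul_eq_mul, mul_one]
      exact hf fun i hi => by simp at hi
  | insert x A hx ih =>
    intro f hf
    -- With `f₊` and `f₋` the functions obtained by fixing the spin at `x`, the function is
    -- `(f₊ + f₋) / 2 + η x * (f₊ - f₋) / 2`.
    have hupd : ∀ u : ℤˣ, ∃ a : Finset V →₀ ℝ, (∀ B ∈ a.support, B ⊆ A) ∧
        ∀ η, spinPoly a η = f (Function.update η x u) := by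
      intro u
      obtain ⟨a, ha, hfa⟩ := ih
        ⟨fun η => f (Function.update η x u), f.continuous.comp (by fun_prop)⟩ (by
          intro η ξ h
          refine hf fun y hy => ?_
          by_cases hyx : y = x
          · subst hyx; simp
          · rw [Function.update_of_ne hyx, Function.update_of_ne hyx]
            simp only [Finset.coe_insert, Set.mem_insert_iff, hyx, false_or] at hy
            exact h y hy)
      exact ⟨a, ha, fun η => by rw [hfa]; rfl⟩
    obtain ⟨a, ha, hfa⟩ := hupd 1
    obtain ⟨b, hb, hfb⟩ := hupd (-1)
    have hmul : ∀ η, spinPoly ((a - b).mapDomain (insert x)) η =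
        ((η x : ℤ) : ℝ) * spinPoly (a - b) η := by
      intro η
      have hsub : ∀ B ∈ (a - b).support, x ∉ B := fun B hB hxB => by
        rcases Finset.mem_union.1 (Finsupp.support_sub hB) with h | h
        · exact hx (ha B h hxB)
        · exact hx (hb B h hxB)
      rw [spinPoly, Finsupp.linearCombination_mapDomain, Finsupp.linearCombination_apply,
        Finsupp.linearCombination_apply, Finsupp.sum, Finsupp.sum, ContinuousMap.sum_apply,
        ContinuousMap.sum_apply, Finset.mul_sum]
      refine Finset.sum_congr rfl fun B hB => ?_
      simp only [Function.comp_apply, ContinuousMap.smul_apply, smul_eq_mul]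
      rw [spinProd_apply, spinProd_apply, Finset.prod_insert (hsub B hB)]
      ring
    refine ⟨(1 / 2 : ℝ) • (a + b + (a - b).mapDomain (insert x)), fun B hB => ?_, ?_⟩
    · rcases Finset.mem_union.1 (Finsupp.support_add (Finsupp.support_smul hB)) with h | h
      · rcases Finset.mem_union.1 (Finsupp.support_add h) with h | h
        · exact (ha B h).trans (Finset.subset_insert _ _)
        · exact (hb B h).trans (Finset.subset_insert _ _)
      · obtain ⟨C, hC, rfl⟩ := Finset.mem_image.1 (Finsupp.mapDomain_support h)
        refine Finset.insert_subset_insert _ ?_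
        rcases Finset.mem_union.1 (Finsupp.support_sub hC) with h | h
        · exact ha C h
        · exact hb C h
    · ext η
      simp only [map_smul, map_add, ContinuousMap.smul_apply, ContinuousMap.add_apply, hmul,
        map_sub, ContinuousMap.sub_apply, hfa, hfb, smul_eq_mul]
      rcases Int.units_eq_one_or (η x) with h | h
      · have : Function.update η x 1 = η := by rw [← h, Function.update_eq_self]
        rw [this, h]; push_cast; ring
      · have : Function.update η x (-1) = η := by rw [← h, Function.update_eq_self]
        rw [this, h]; push_cast; ring

/-- The algebra of continuous functions that depend on finitely many spins. -/
def cylinderAlgebra (V : Type*) : Subalgebra ℝ C(Config V, ℝ) where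
  carrier := {f | IsCylinder f}
  mul_mem' := by
    classical
    rintro f g ⟨A, hA⟩ ⟨B, hB⟩
    refine ⟨A ∪ B, fun η ξ h => ?_⟩
    have h1 := hA fun i hi => h i (by simp_all)
    have h2 := hB fun i hi => h i (by simp_all)
    simp [h1, h2]
  add_mem' := by
    classical
    rintro f g ⟨A, hA⟩ ⟨B, hB⟩
    refine ⟨A ∪ B, fun η ξ h => ?_⟩
    have h1 := hA fun i hi => h i (by simp_all)
    have h2 := hB fun i hi => h i (by simp_all)
    simp [h1, h2]
  algebraMap_mem' c := ⟨∅, fun η ξ _ => rfl⟩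

lemma denseRange_spinPoly : DenseRange (spinPoly (V := V)) := by
  have hsep : (cylinderAlgebra V).SeparatesPoints := by
    intro η ξ hne
    obtain ⟨x, hx⟩ := Function.ne_iff.1 hne
    refine ⟨spin x, ⟨spin x, ⟨{x}, fun η ξ h => ?_⟩, rfl⟩, fun h => hx ?_⟩
    · simp [h x (by simp)]
    · simpa [Units.ext_iff] using h
  have htop := ContinuousMap.subalgebra_topologicalClosure_eq_top_of_separatesPoints _ hsep
  intro f
  have hf : f ∈ (cylinderAlgebra V).topologicalClosure := htop ▸ Algebra.mem_top
  refine closure_mono ?_ hf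
  rintro g ⟨A, hA⟩
  obtain ⟨a, -, ha⟩ := mem_range_spinPoly_of_dependsOn A g hA
  exact ⟨a, ha⟩

end Density

/-! ### The Feller semigroup -/

section Semigroup

variable {V : Type*} (G : SimpleGraph V) [G.LocallyFinite] (s : Sym2 V → ℤˣ)

/-- The semigroup of the model: the continuous extension of the exponential series from spin
polynomials to all continuous functions. -/
noncomputable def semigroup (t : ℝ≥0) : C(Config V, ℝ) →L[ℝ] C(Config V, ℝ) :=
  (expOperator G s t).extendOfNorm spinPoly

lemma semigroup_spinPoly (t : ℝ≥0) (a : Finset V →₀ ℝ) :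
    semigroup G s t (spinPoly a) = expOperator G s t a :=
  LinearMap.extendOfNorm_eq denseRange_spinPoly ⟨1, norm_expOperator_le G s t.coe_nonneg⟩ a

lemma norm_semigroup_apply_le (t : ℝ≥0) (f : C(Config V, ℝ)) : ‖semigroup G s t f‖ ≤ ‖f‖ :=
  (LinearMap.norm_extendOfNorm_apply_le denseRange_spinPoly 1
    (norm_expOperator_le G s t.coe_nonneg) f).trans_eq (one_mul _)

lemma semigroup_zero (f : C(Config V, ℝ)) : semigroup G s 0 f = f := by
  refine denseRange_spinPoly.induction_on f (isClosed_eq (by fun_prop) (by fun_prop)) fun a => ?_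
  rw [semigroup_spinPoly, expOperator_apply, tsum_eq_single 0 (by intro n hn; simp [hn])]
  simp

lemma semigroup_add (t u : ℝ≥0) (f : C(Config V, ℝ)) :
    semigroup G s (t + u) f = semigroup G s t (semigroup G s u f) := by
  refine denseRange_spinPoly.induction_on f (isClosed_eq (by fun_prop) (by fun_prop)) fun a => ?_
  obtain ⟨C, K, -, hK, h⟩ := exists_norm_spinPoly_pow_le G s a
  rw [semigroup_spinPoly, semigroup_spinPoly, expOperator_apply _ _ (u : ℝ),
    (semigroup G s t).map_tsum (summable_expSeries h u), expOperator_apply, NNReal.coe_add,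
    add_comm (t : ℝ), ← tsum_tsum_expSeries hK h t.coe_nonneg u.coe_nonneg]
  refine tsum_congr fun m => ?_
  rw [map_smul, semigroup_spinPoly, expOperator_apply]
  simp only [← Module.End.mul_apply, ← pow_add, add_comm]

lemma semigroup_one (t : ℝ≥0) : semigroup G s t 1 = 1 := by
  have h1 : spinPoly (Finsupp.single (∅ : Finset V) 1) = 1 := by simp [spinProd]
  have h2 : dualOperator G s (Finsupp.single ∅ 1) = 0 := by simp [dualOperator_single]
  rw [← h1, semigroup_spinPoly, expOperator_apply, tsum_eq_single 0 (fun n hn => ?_)]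
  · simp
  · obtain ⟨m, rfl⟩ := Nat.exists_eq_succ_of_ne_zero hn
    have h3 : (dualOperator G s ^ (m + 1)) (Finsupp.single ∅ 1) = 0 := by
      rw [pow_succ, Module.End.mul_apply, h2, map_zero]
    rw [Nat.succ_eq_add_one, h3, map_zero, smul_zero]

/-- A unital contraction is positive: a function with values in `[0, c]` is within `c / 2` of the
constant `c / 2`. -/
lemma semigroup_nonneg (t : ℝ≥0) (f : C(Config V, ℝ)) (hf : 0 ≤ f) : 0 ≤ semigroup G s t f := by
  intro η
  set c := ‖f‖ with hc
  have h1 : ‖(c / 2) • (1 : C(Config V, ℝ)) - f‖ ≤ c / 2 := by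
    refine (ContinuousMap.norm_le _ (by positivity)).2 fun ξ => abs_le.2 ?_
    have h2 : 0 ≤ f ξ := hf ξ
    have h3 : f ξ ≤ c := (le_abs_self _).trans (f.norm_coe_le_norm ξ)
    simp only [ContinuousMap.sub_apply, ContinuousMap.smul_apply, ContinuousMap.one_apply,
      smul_eq_mul, mul_one]
    constructor <;> linarith
  have h4 := ((semigroup G s t ((c / 2) • (1 : C(Config V, ℝ)) - f)).norm_coe_le_norm η).trans
    ((norm_semigroup_apply_le G s t _).trans h1)
  rw [map_sub, map_smul, semigroup_one] at h4
  have h5 := (abs_le.1 h4).2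
  simp only [ContinuousMap.sub_apply, ContinuousMap.smul_apply, ContinuousMap.one_apply,
    smul_eq_mul, mul_one] at h5
  change 0 ≤ semigroup G s t f η
  linarith

lemma continuous_semigroup (f : C(Config V, ℝ)) : Continuous fun t => semigroup G s t f := by
  refine continuous_of_uniform_approx_of_continuous fun u hu => ?_
  obtain ⟨ε, hε, hεu⟩ := Metric.mem_uniformity_dist.1 hu
  obtain ⟨a, ha⟩ := denseRange_spinPoly.exists_dist_lt f hε
  obtain ⟨C, K, -, -, h⟩ := exists_norm_spinPoly_pow_le G s a
  refine ⟨fun t => expOperator G s t a, (continuous_expSeries h).comp NNReal.continuous_coe,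
    fun t => hεu ?_⟩
  change dist _ (expOperator G s t a) < ε
  rw [← semigroup_spinPoly, dist_eq_norm, ← map_sub]
  exact (norm_semigroup_apply_le G s t _).trans_lt (by rwa [← dist_eq_norm])

theorem isSemigroup_semigroup : IsSemigroup G s (semigroup G s) where
  zero := semigroup_zero G s
  add := semigroup_add G s
  one := semigroup_one G s
  nonneg := semigroup_nonneg G s
  continuous := continuous_semigroup G s
  generator := by
    rintro f ⟨A, hA⟩
    obtain ⟨a, -, rfl⟩ := mem_range_spinPoly_of_dependsOn A f hA
    obtain ⟨C, K, -, -, h⟩ := exists_norm_spinPoly_pow_le G s a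
    obtain ⟨D, hD⟩ := norm_expSeries_sub_le h
    rw [operator_spinPoly, Metric.tendstoUniformly_iff]
    intro ε hε
    have hlim : Tendsto (fun t : ℝ≥0 => D * (t : ℝ)) (𝓝[>] 0) (𝓝 0) := by
      have : Tendsto (fun t : ℝ≥0 => D * (t : ℝ)) (𝓝 0) (𝓝 (D * ((0 : ℝ≥0) : ℝ))) :=
        (continuous_const.mul NNReal.continuous_coe).tendsto 0
      rw [NNReal.coe_zero, mul_zero] at this
      exact this.mono_left nhdsWithin_le_nhds
    filter_upwards [hlim.eventually (gt_mem_nhds hε), Ioo_mem_nhdsGT (zero_lt_one' ℝ≥0)]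
      with t htε ht η
    have ht0 : (0 : ℝ) < t := ht.1
    have h0 := hD t t.coe_nonneg ht.2.le
    rw [← expOperator_apply, pow_zero, pow_one, Module.End.one_apply, ← semigroup_spinPoly] at h0
    have h1 := ((semigroup G s t (spinPoly a) - spinPoly a -
      (t : ℝ) • spinPoly (dualOperator G s a)).norm_coe_le_norm η).trans h0
    rw [dist_comm, Real.dist_eq]
    simp only [ContinuousMap.sub_apply, ContinuousMap.smul_apply, smul_eq_mul,
      Real.norm_eq_abs] at h1
    have h2 : (semigroup G s t (spinPoly a) η - spinPoly a η) / (t : ℝ) -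
        spinPoly (dualOperator G s a) η = (semigroup G s t (spinPoly a) η - spinPoly a η -
          t * spinPoly (dualOperator G s a) η) / t := by
      field_simp
    rw [h2, abs_div, abs_of_pos ht0, div_lt_iff₀ ht0]
    refine h1.trans_lt ?_
    rw [pow_two, ← mul_assoc]
    exact mul_lt_mul_of_pos_right htε ht0

end Semigroup

/-! ### Existence of equilibria -/

section Equilibria

variable {V : Type*} {G : SimpleGraph V} [G.LocallyFinite] {s : Sym2 V → ℤˣ}
  {T : ℝ≥0 → C(Config V, ℝ) →L[ℝ] C(Config V, ℝ)}

open scoped CompactlySupported in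
/-- A positive unital linear functional on continuous functions is integration against a
probability measure. -/
lemma exists_isProbabilityMeasure_integral_eq [Countable V] (Λ : C(Config V, ℝ) →ₗ[ℝ] ℝ)
    (hpos : ∀ f, 0 ≤ f → 0 ≤ Λ f) (hone : Λ 1 = 1) :
    ∃ μ : Measure (Config V), IsProbabilityMeasure μ ∧ ∀ f, ∫ η, f η ∂μ = Λ f := by
  let Φ : C_c(Config V, ℝ) →ₚ[ℝ] ℝ :=
  { toFun g := Λ g.toContinuousMap
    map_add' g g' := Λ.map_add _ _
    map_smul' c g := Λ.map_smul c _
    monotone' g g' h := by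
      have := hpos (g'.toContinuousMap - g.toContinuousMap) (sub_nonneg.2 h)
      rw [map_sub] at this
      exact sub_nonneg.1 this }
  have hint : ∀ f : C(Config V, ℝ), ∫ η, f η ∂(RealRMK.rieszMeasure Φ) = Λ f := fun f =>
    RealRMK.integral_rieszMeasure Φ ⟨f, HasCompactSupport.of_compactSpace _⟩
  refine ⟨RealRMK.rieszMeasure Φ, ⟨?_⟩, hint⟩
  have h1 := hint 1
  rw [hone] at h1
  simp only [ContinuousMap.one_apply, integral_const, smul_eq_mul, mul_one] at h1
  rw [measureReal_def] at h1
  rw [← ENNReal.ofReal_toReal (a := RealRMK.rieszMeasure Φ Set.univ), h1, ENNReal.ofReal_one]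
  intro h
  simp [h] at h1

/-- The average over the times in `[0, n + 1]` of the semigroup started from `ξ`. -/
noncomputable def timeAverage (T : ℝ≥0 → C(Config V, ℝ) →L[ℝ] C(Config V, ℝ)) (ξ : Config V)
    (n : ℕ) (f : C(Config V, ℝ)) : ℝ :=
  (1 / (n + 1 : ℝ)) * ∫ u in (0 : ℝ)..(n + 1), T u.toNNReal f ξ

lemma IsSemigroup.norm_apply_le (hT : IsSemigroup G s T) (t : ℝ≥0) (f : C(Config V, ℝ))
    (ξ : Config V) : |T t f ξ| ≤ ‖f‖ := by
  have h1 : 0 ≤ T t (‖f‖ • 1 - f) := hT.nonneg _ _ fun η => by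
    simpa using (le_abs_self _).trans (f.norm_coe_le_norm η)
  have h2 : 0 ≤ T t (‖f‖ • 1 + f) := hT.nonneg _ _ fun η => by
    have := (abs_le.1 (f.norm_coe_le_norm η)).1
    change 0 ≤ ‖f‖ * 1 + f η
    linarith
  have h1' : 0 ≤ T t (‖f‖ • 1 - f) ξ := h1 ξ
  have h2' : 0 ≤ T t (‖f‖ • 1 + f) ξ := h2 ξ
  rw [map_sub, map_smul, hT.one] at h1'
  rw [map_add, map_smul, hT.one] at h2'
  simp only [ContinuousMap.sub_apply, ContinuousMap.add_apply,
    ContinuousMap.smul_apply, ContinuousMap.one_apply, smul_eq_mul, mul_one] at h1' h2'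
  exact abs_le.2 ⟨by linarith, by linarith⟩

lemma IsSemigroup.continuous_apply (hT : IsSemigroup G s T) (f : C(Config V, ℝ))
    (ξ : Config V) : Continuous fun u : ℝ => T u.toNNReal f ξ :=
  (ContinuousMap.evalCLM ℝ ξ).continuous.comp ((hT.continuous f).comp continuous_real_toNNReal)

lemma le_timeAverage (hT : IsSemigroup G s T) {f : C(Config V, ℝ)} {ξ : Config V} {c : ℝ}
    (hc : ∀ t, c ≤ T t f ξ) (n : ℕ) : c ≤ timeAverage T ξ n f := by
  have hn : (0 : ℝ) < n + 1 := by positivity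
  have h := intervalIntegral.integral_mono_on hn.le
    (intervalIntegrable_const (μ := volume) (c := c))
    ((hT.continuous_apply f ξ).intervalIntegrable 0 (n + 1 : ℝ)) (fun u _ => hc u.toNNReal)
  rw [intervalIntegral.integral_const, sub_zero, smul_eq_mul] at h
  rw [timeAverage, one_div, le_inv_mul_iff₀ hn]
  exact h

lemma timeAverage_add (hT : IsSemigroup G s T) (ξ : Config V) (n : ℕ) (f g : C(Config V, ℝ)) :
    timeAverage T ξ n (f + g) = timeAverage T ξ n f + timeAverage T ξ n g := by
  simp only [timeAverage, map_add, ContinuousMap.add_apply]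
  rw [intervalIntegral.integral_add ((hT.continuous_apply f ξ).intervalIntegrable _ _)
    ((hT.continuous_apply g ξ).intervalIntegrable _ _), mul_add]

lemma timeAverage_smul (ξ : Config V) (n : ℕ) (c : ℝ) (f : C(Config V, ℝ)) :
    timeAverage T ξ n (c • f) = c * timeAverage T ξ n f := by
  simp only [timeAverage, map_smul, ContinuousMap.smul_apply, smul_eq_mul,
    intervalIntegral.integral_const_mul]
  ring

lemma abs_timeAverage_le (hT : IsSemigroup G s T) (ξ : Config V) (n : ℕ) (f : C(Config V, ℝ)) :
    |timeAverage T ξ n f| ≤ ‖f‖ := by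
  refine abs_le.2 ⟨le_timeAverage hT (fun t => (abs_le.1 (hT.norm_apply_le t f ξ)).1) n, ?_⟩
  have h := le_timeAverage hT (f := (-1 : ℝ) • f) (ξ := ξ) (c := -‖f‖) (fun t => by
    simpa using (abs_le.1 (hT.norm_apply_le t f ξ)).2) n
  rw [timeAverage_smul] at h
  linarith

/-- The time averages are asymptotically invariant: shifting the time by `t` changes the integral
at the two ends of the interval only. -/
lemma abs_timeAverage_sub_le (hT : IsSemigroup G s T) (ξ : Config V) (n : ℕ) (t : ℝ≥0)
    (f : C(Config V, ℝ)) :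
    |timeAverage T ξ n (T t f) - timeAverage T ξ n f| ≤ 2 * t * ‖f‖ * (1 / (n + 1 : ℝ)) := by
  set F : ℝ → ℝ := fun u => T u.toNNReal f ξ with hF
  have hFc : Continuous F := hT.continuous_apply f ξ
  have hi : ∀ a b, IntervalIntegrable F volume a b := fun a b => hFc.intervalIntegrable a b
  have hn : (0 : ℝ) ≤ n + 1 := by positivity
  have h1 : ∫ u in (0 : ℝ)..(n + 1), T u.toNNReal (T t f) ξ = ∫ u in (t : ℝ)..(n + 1 + t), F u := by
    have : ∫ u in (0 : ℝ)..(n + 1), F (u + t) = ∫ u in (t : ℝ)..(n + 1 + t), F u := by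
      rw [intervalIntegral.integral_comp_add_right, zero_add]
    rw [← this]
    refine intervalIntegral.integral_congr fun u hu => ?_
    rw [Set.uIcc_of_le hn] at hu
    change _ = T (u + t).toNNReal f ξ
    rw [Real.toNNReal_add hu.1 t.coe_nonneg, Real.toNNReal_coe, hT.add]
  have h2 : ∫ u in (t : ℝ)..(n + 1 + t), F u =
      (∫ u in (0 : ℝ)..(n + 1), F u) + (∫ u in (n + 1 : ℝ)..(n + 1 + t), F u) -
        ∫ u in (0 : ℝ)..t, F u := by
    rw [intervalIntegral.integral_add_adjacent_intervals (hi _ _) (hi _ _), eq_sub_iff_add_eq,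
      add_comm, intervalIntegral.integral_add_adjacent_intervals (hi _ _) (hi _ _)]
  have hb : ∀ a b : ℝ, |∫ u in a..b, F u| ≤ ‖f‖ * |b - a| := fun a b =>
    intervalIntegral.norm_integral_le_of_norm_le_const (f := F) fun u _ => hT.norm_apply_le _ f ξ
  have h3 := hb (n + 1) (n + 1 + t)
  have h4 := hb 0 t
  rw [add_sub_cancel_left, abs_of_nonneg t.coe_nonneg] at h3
  rw [sub_zero, abs_of_nonneg t.coe_nonneg] at h4
  rw [timeAverage, timeAverage, h1, h2, ← mul_sub, abs_mul, abs_of_nonneg (by positivity), mul_comm]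
  refine mul_le_mul_of_nonneg_right ?_ (by positivity)
  have h5 := abs_le.1 h3
  have h6 := abs_le.1 h4
  rw [abs_le]
  constructor <;> linarith

/-- Time averages of the process started from `ξ` have a limit point, which is an equilibrium.
Lower bounds on expectations that hold at all times are inherited. -/
theorem IsSemigroup.exists_isEquilibrium [Countable V] (hT : IsSemigroup G s T) (ξ : Config V) :
    ∃ μ, IsEquilibrium T μ ∧ ∀ (f : C(Config V, ℝ)) (c : ℝ),
      (∀ t, c ≤ T t f ξ) → c ≤ ∫ η, f η ∂μ := by
  have hlim : ∀ f : C(Config V, ℝ), ∃ l,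
      Tendsto (fun n => timeAverage T ξ n f) (hyperfilter ℕ : Filter ℕ) (𝓝 l) := by
    intro f
    obtain ⟨l, -, hl⟩ := (isCompact_Icc (a := -‖f‖) (b := ‖f‖)).ultrafilter_le_nhds
      ((hyperfilter ℕ).map fun n => timeAverage T ξ n f) (le_principal_iff.2
        (Eventually.of_forall (f := (hyperfilter ℕ : Filter ℕ)) fun n =>
          abs_le.1 (abs_timeAverage_le hT ξ n f)))
    exact ⟨l, hl⟩
  choose l hl using hlim
  have hnat : (hyperfilter ℕ : Filter ℕ) ≤ atTop := by
    rw [← Nat.cofinite_eq_atTop]; exact hyperfilter_le_cofinite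
  let Λ : C(Config V, ℝ) →ₗ[ℝ] ℝ :=
  { toFun := l
    map_add' f g := tendsto_nhds_unique (hl (f + g))
      (((hl f).add (hl g)).congr fun n => (timeAverage_add hT ξ n f g).symm)
    map_smul' c f := tendsto_nhds_unique (hl (c • f))
      (((hl f).const_mul c).congr fun n => (timeAverage_smul ξ n c f).symm) }
  have hle : ∀ (f : C(Config V, ℝ)) (c : ℝ), (∀ t, c ≤ T t f ξ) → c ≤ Λ f := fun f c hc =>
    ge_of_tendsto' (hl f) fun n => le_timeAverage hT hc n
  have hone : Λ 1 = 1 := by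
    refine le_antisymm ?_ (hle 1 1 fun t => by simp [hT.one])
    have := hle (-1) (-1) fun t => by simp [hT.one]
    rw [map_neg] at this
    linarith
  obtain ⟨μ, hμ, hint⟩ := exists_isProbabilityMeasure_integral_eq Λ
    (fun f hf => hle f 0 fun t => hT.nonneg t f hf ξ) hone
  refine ⟨μ, ⟨hμ, fun t f => ?_⟩, fun f c hc => (hle f c hc).trans_eq (hint f).symm⟩
  rw [hint, hint]
  have h1 : Tendsto (fun n : ℕ => 2 * t * ‖f‖ * (1 / (n + 1 : ℝ))) (hyperfilter ℕ : Filter ℕ)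
      (𝓝 0) := by
    simpa using ((tendsto_one_div_add_atTop_nhds_zero_nat (𝕜 := ℝ)).const_mul
      (2 * (t : ℝ) * ‖f‖)).mono_left hnat
  have h2 := squeeze_zero_norm
    (f := fun n => timeAverage T ξ n (T t f) - timeAverage T ξ n f)
    (fun n => abs_timeAverage_sub_le hT ξ n t f) h1
  exact sub_eq_zero.1 (tendsto_nhds_unique ((hl (T t f)).sub (hl f)) h2)

end Equilibria

/-! ### Multiple equilibria from a supersolution -/

section Supersolution

variable {V : Type*} (G : SimpleGraph V) [G.LocallyFinite] (s : Sym2 V → ℤˣ)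

/-- The transition operator of the random walk, weighted with the signs of the edges. -/
noncomputable def signedStep : Module.End ℝ (V → ℝ) where
  toFun u x := (1 / (G.degree x : ℝ)) * ∑ y ∈ G.neighborFinset x, ((s s(x, y) : ℤ) : ℝ) * u y
  map_add' u v := by
    ext x
    simp only [Pi.add_apply, mul_add, Finset.sum_add_distrib]
  map_smul' c u := by
    ext x
    simp only [Pi.smul_apply, smul_eq_mul, RingHom.id_apply, Finset.mul_sum]
    exact Finset.sum_congr rfl fun y _ => by ring

lemma signedStep_apply (u : V → ℝ) (x : V) : signedStep G s u x =
    (1 / (G.degree x : ℝ)) * ∑ y ∈ G.neighborFinset x, ((s s(x, y) : ℤ) : ℝ) * u y := rfl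

variable {G s}

lemma moveParticle_singleton (x y : V) : moveParticle {x} x y = {y} := by
  simp [moveParticle]

/-- On single spins the dual process is one random walk, and the operator is the signed step minus
the identity. -/
lemma spinPoly_dualOperator_pow_singleton (hdeg : ∀ x, 0 < G.degree x) (η : Config V) (n : ℕ) :
    (fun x => spinPoly ((dualOperator G s ^ n) (Finsupp.single {x} 1)) η) =
      ((signedStep G s - 1) ^ n) fun x => ((η x : ℤ) : ℝ) := by
  induction n with
  | zero => ext x; simp [spinProd_apply]
  | succ n ih =>
    rw [pow_succ' (signedStep G s - 1), Module.End.mul_apply, ← ih]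
    ext x
    have hd : (G.degree x : ℝ) ≠ 0 := by exact_mod_cast (hdeg x).ne'
    rw [pow_succ, Module.End.mul_apply, dualOperator_single]
    simp only [one_smul, Finset.sum_singleton, moveParticle_singleton, map_smul, map_sum, map_sub,
      ContinuousMap.smul_apply, ContinuousMap.sum_apply, ContinuousMap.sub_apply, smul_eq_mul,
      LinearMap.sub_apply, Module.End.one_apply, Pi.sub_apply, signedStep_apply]
    rw [Finset.sum_sub_distrib, Finset.sum_const, G.card_neighborFinset_eq_degree, nsmul_eq_mul,
      mul_sub, one_div, inv_mul_cancel_left₀ hd]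

lemma abs_signedStep_pow_le {w : V → ℝ} (hw : ∀ x, |w x| ≤ 1) (n : ℕ) (x : V) :
    |(signedStep G s ^ n) w x| ≤ 1 := by
  induction n generalizing x with
  | zero => exact hw x
  | succ n ih =>
    rw [pow_succ', Module.End.mul_apply, signedStep_apply, abs_mul, abs_of_nonneg (by positivity)]
    have h : |∑ y ∈ G.neighborFinset x, ((s s(x, y) : ℤ) : ℝ) * (signedStep G s ^ n) w y| ≤
        G.degree x := by
      refine (Finset.abs_sum_le_sum_abs _ _).trans ?_
      refine (Finset.sum_le_card_nsmul _ _ 1 fun y _ => ?_).trans (by simp)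
      rw [abs_mul, abs_unit, one_mul]
      exact ih y
    calc 1 / (G.degree x : ℝ) * _ ≤ 1 / (G.degree x : ℝ) * G.degree x := by gcongr
      _ ≤ 1 := by rw [one_div]; exact inv_mul_le_one

/-- The expected sign collected by the walk in `n` steps is at least `1 - g` for every nonnegative
`g` that dominates twice the expected number of negative edges crossed. -/
lemma one_sub_le_signedStep_pow (hdeg : ∀ x, 0 < G.degree x) {g : V → ℝ} (hg : ∀ x, 0 ≤ g x)
    (hsup : ∀ x, ∑ y ∈ G.neighborFinset x, (g y + (1 - ((s s(x, y) : ℤ) : ℝ))) ≤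
      G.degree x * g x) (n : ℕ) (x : V) : 1 - g x ≤ (signedStep G s ^ n) 1 x := by
  induction n generalizing x with
  | zero => simpa using hg x
  | succ n ih =>
    have hd : (0 : ℝ) < G.degree x := by exact_mod_cast hdeg x
    rw [pow_succ', Module.End.mul_apply, signedStep_apply, one_div, le_inv_mul_iff₀ hd, mul_sub,
      mul_one]
    have h : ∀ y ∈ G.neighborFinset x, 1 - (g y + (1 - ((s s(x, y) : ℤ) : ℝ))) ≤
        ((s s(x, y) : ℤ) : ℝ) * (signedStep G s ^ n) 1 y := by
      intro y _
      have h1 := ih y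
      have h2 := (abs_le.1 (abs_signedStep_pow_le (G := G) (s := s) (w := 1) (by simp) n y)).2
      rcases Int.units_eq_one_or (s s(x, y)) with h3 | h3 <;> rw [h3] <;> push_cast
      · linarith
      · linarith [hg y]
    have h2 := Finset.sum_le_sum h
    rw [Finset.sum_sub_distrib, Finset.sum_const, G.card_neighborFinset_eq_degree, nsmul_eq_mul,
      mul_one] at h2
    linarith [hsup x]

/-- Passing from the jump chain to the continuous-time walk: the number of jumps up to time `t`
is a Poisson variable. -/
lemma exp_mul_tsum_signedStep {w : V → ℝ} (hw : ∀ x, |w x| ≤ 1) (t : ℝ) (x : V) :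
    Real.exp (-t) * ∑' n : ℕ, t ^ n / n.factorial * (signedStep G s ^ n) w x =
      ∑' n : ℕ, t ^ n / n.factorial * ((signedStep G s - 1) ^ n) w x := by
  have hs : Summable fun n : ℕ => ‖t ^ n / n.factorial * (signedStep G s ^ n) w x‖ :=
    summable_norm_expSeries (C := 1) (K := 1) (v := fun n => (signedStep G s ^ n) w x)
      (fun n => by simpa using abs_signedStep_pow_le hw n x) t
  have he : Real.exp (-t) = ∑' n : ℕ, (-t) ^ n / n.factorial := by
    rw [Real.exp_eq_exp_ℝ, NormedSpace.exp_eq_tsum_div]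
  rw [he, tsum_mul_tsum_eq_tsum_sum_antidiagonal_of_summable_norm
      (Real.summable_pow_div_factorial (-t)).norm hs]
  refine tsum_congr fun n => ?_
  have hcomm : Commute ((-1 : ℝ) • (1 : Module.End ℝ (V → ℝ))) (signedStep G s) :=
    (Commute.one_left _).smul_left _
  have hsub : signedStep G s - 1 = (-1 : ℝ) • (1 : Module.End ℝ (V → ℝ)) + signedStep G s := by
    refine LinearMap.ext fun u => funext fun x => ?_
    simp only [LinearMap.sub_apply, LinearMap.add_apply, LinearMap.smul_apply, Pi.sub_apply,
      Pi.add_apply, Pi.smul_apply, Module.End.one_apply, smul_eq_mul]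
    ring
  rw [hsub, hcomm.add_pow', LinearMap.sum_apply, Finset.sum_apply, Finset.mul_sum]
  refine Finset.sum_congr rfl fun p hp => ?_
  rw [Finset.HasAntidiagonal.mem_antidiagonal] at hp
  subst hp
  have h1 : (((-1 : ℝ) • (1 : Module.End ℝ (V → ℝ))) ^ p.1 * signedStep G s ^ p.2) w x =
      (-1) ^ p.1 * (signedStep G s ^ p.2) w x := by
    rw [smul_pow, one_pow, smul_one_mul, LinearMap.smul_apply, Pi.smul_apply, smul_eq_mul]
  rw [LinearMap.smul_apply, Pi.smul_apply, h1, nsmul_eq_mul]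
  have h2 : ((p.1 + p.2).choose p.1 : ℝ) * p.1.factorial * p.2.factorial =
      (p.1 + p.2).factorial := by
    rw [Nat.choose_symm_add]
    exact_mod_cast Nat.add_choose_mul_factorial_mul_factorial p.1 p.2
  have h3 : (p.1.factorial : ℝ) ≠ 0 := by positivity
  have h4 : (p.2.factorial : ℝ) ≠ 0 := by positivity
  have h5 : ((p.1 + p.2).factorial : ℝ) ≠ 0 := by positivity
  rw [neg_pow t, pow_add]
  field_simp
  rw [← h2]; ring

lemma semigroup_spin_apply (hdeg : ∀ x, 0 < G.degree x) (t : ℝ≥0) (x : V) (η : Config V) :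
    semigroup G s t (spin x) η = ∑' n : ℕ, (t : ℝ) ^ n / n.factorial *
      ((signedStep G s - 1) ^ n) (fun x => ((η x : ℤ) : ℝ)) x := by
  have h : spinPoly (Finsupp.single {x} 1) = spin x := by simp [spinProd]
  rw [← h, semigroup_spinPoly, expOperator_eq_tsum_eval]
  refine tsum_congr fun n => ?_
  rw [← spinPoly_dualOperator_pow_singleton hdeg]

lemma one_sub_le_semigroup_spin (hdeg : ∀ x, 0 < G.degree x) {g : V → ℝ} (hg : ∀ x, 0 ≤ g x)
    (hsup : ∀ x, ∑ y ∈ G.neighborFinset x, (g y + (1 - ((s s(x, y) : ℤ) : ℝ))) ≤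
      G.degree x * g x) (t : ℝ≥0) (x : V) : 1 - g x ≤ semigroup G s t (spin x) 1 := by
  have h1 : (fun x => (((1 : Config V) x : ℤ) : ℝ)) = 1 := by ext; simp
  rw [semigroup_spin_apply hdeg, h1, ← exp_mul_tsum_signedStep (by simp)]
  have hsum : Summable fun n : ℕ => (t : ℝ) ^ n / n.factorial * (signedStep G s ^ n) 1 x :=
    summable_expSeries (C := 1) (K := 1)
        (v := fun n => (signedStep G s ^ n) 1 x)
        (fun n => by simpa using abs_signedStep_pow_le (by simp) n x) t
  have h2 : ∑' n : ℕ, (t : ℝ) ^ n / n.factorial * (1 - g x) ≤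
      ∑' n : ℕ, (t : ℝ) ^ n / n.factorial * (signedStep G s ^ n) 1 x :=
    ((Real.summable_pow_div_factorial t).mul_right _).tsum_le_tsum (fun n => by
      have := t.coe_nonneg
      have := one_sub_le_signedStep_pow hdeg hg hsup n x
      gcongr) hsum
  have h3 : ∑' n : ℕ, (t : ℝ) ^ n / n.factorial = Real.exp t := by
    rw [Real.exp_eq_exp_ℝ, NormedSpace.exp_eq_tsum_div]
  rw [tsum_mul_right, h3] at h2
  calc 1 - g x = Real.exp (-t) * (Real.exp t * (1 - g x)) := by
        rw [← mul_assoc, ← Real.exp_add]; simp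
    _ ≤ _ := by gcongr

lemma semigroup_spin_neg_one (hdeg : ∀ x, 0 < G.degree x) (t : ℝ≥0) (x : V) :
    semigroup G s t (spin x) (-1) = -semigroup G s t (spin x) 1 := by
  have h1 : (fun x => (((-1 : Config V) x : ℤ) : ℝ)) =
      -fun x => (((1 : Config V) x : ℤ) : ℝ) := by ext; simp
  rw [semigroup_spin_apply hdeg, semigroup_spin_apply hdeg, h1]
  simp only [map_neg, Pi.neg_apply, mul_neg, tsum_neg]

/-- If twice the expected number of negative edges crossed by the walk from some site is less
than `1`, then the equilibria reached from the configurations `1` and `-1` are different. -/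
theorem hasMultipleEquilibria_of_supersolution [Countable V] (hdeg : ∀ x, 0 < G.degree x)
    {g : V → ℝ} (hg : ∀ x, 0 ≤ g x)
    (hsup : ∀ x, ∑ y ∈ G.neighborFinset x, (g y + (1 - ((s s(x, y) : ℤ) : ℝ))) ≤
      G.degree x * g x) {x : V} (hx : g x < 1) : HasMultipleEquilibria G s := by
  have hT := isSemigroup_semigroup G s
  obtain ⟨μ, hμ, hμf⟩ := hT.exists_isEquilibrium 1
  obtain ⟨ν, hν, hνf⟩ := hT.exists_isEquilibrium (-1)
  refine ⟨_, hT, μ, ν, hμ, hν, fun h => ?_⟩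
  have h1 := hμf (spin x) (1 - g x) fun t => one_sub_le_semigroup_spin hdeg hg hsup t x
  have h2 := hνf (-spin x) (1 - g x) fun t => by
    rw [map_neg, ContinuousMap.neg_apply, semigroup_spin_neg_one hdeg, neg_neg]
    exact one_sub_le_semigroup_spin hdeg hg hsup t x
  simp only [ContinuousMap.neg_apply, integral_neg] at h2
  rw [h] at h1
  linarith

end Supersolution

/-! ### Staying in a region -/

section Stay

variable {V : Type*}

lemma ae_pos_expMeasure : ∀ᵐ u ∂expMeasure 1, 0 < u := by
  have := isProbabilityMeasure_expMeasure (r := 1) one_pos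
  have h := cdf_expMeasure_eq (r := 1) one_pos 0
  rw [cdf_eq_real] at h
  simp only [le_refl, if_true, mul_zero, neg_zero, Real.exp_zero, sub_self] at h
  rw [ae_iff]
  have h2 : {u : ℝ | ¬0 < u} = Set.Iic 0 := by ext; simp
  rw [h2]
  exact (measureReal_eq_zero_iff).1 h

lemma ae_pos_holdingTimes :
    ∀ᵐ τ ∂(Measure.infinitePi fun _ : ℕ => expMeasure 1), ∀ k, 0 < τ k := by
  have := isProbabilityMeasure_expMeasure (r := 1) one_pos
  exact ae_all_iff.2 fun k =>
    (measurePreserving_eval_infinitePi (fun _ : ℕ => expMeasure 1) k).quasiMeasurePreserving.ae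
      ae_pos_expMeasure

lemma position_sum {ω : (ℕ → V) × (ℕ → ℝ)} (h : ∀ k, 0 < ω.2 k) (n : ℕ) :
    position ω (∑ k ∈ Finset.range n, ω.2 k) = ω.1 n := by
  have hmono : StrictMono fun m => ∑ k ∈ Finset.range m, ω.2 k :=
    strictMono_nat_of_lt_succ fun m => by
      simp only [Finset.sum_range_succ]; linarith [h m]
  have hset : {m : ℕ | ∑ k ∈ Finset.range m, ω.2 k ≤ ∑ k ∈ Finset.range n, ω.2 k} = Set.Iic n := by
    ext m
    exact hmono.le_iff_le
  rw [position, hset, csSup_Iic]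

/-- One step of the walk, killed when it leaves `W` (acting on functions). -/
noncomputable def killedStep (G : SimpleGraph V) [G.LocallyFinite] (W : Set V) (u : V → ℝ) :
    V → ℝ :=
  W.indicator fun x => (1 / (G.degree x : ℝ)) * ∑ y ∈ G.neighborFinset x, u y

lemma killedStep_nonneg {G : SimpleGraph V} [G.LocallyFinite] (W : Set V) {u : V → ℝ}
    (hu : ∀ x, 0 ≤ u x) (x : V) :
    0 ≤ killedStep G W u x :=
  Set.indicator_nonneg (fun x _ => mul_nonneg (by positivity)
    (Finset.sum_nonneg fun y _ => hu y)) x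

variable [MeasurableSpace V] [DiscreteMeasurableSpace V] (G : SimpleGraph V) [G.LocallyFinite]

instance (x : V) : IsProbabilityMeasure (jumpChain G x) := by
  unfold jumpChain; infer_instance

/-- Almost surely the continuous-time walk visits every site of its jump chain, as the holding
times are positive. -/
lemma stayProb_le_jumpChain (x : V) (W : Set V) :
    stayProb G x W ≤ jumpChain G x {ω | ∀ n, ω n ∈ W} := by
  have := isProbabilityMeasure_expMeasure (r := 1) one_pos
  have hsub : {ω : (ℕ → V) × (ℕ → ℝ) | ∀ t : ℝ, 0 ≤ t → position ω t ∈ W} ⊆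
      {ω : ℕ → V | ∀ n, ω n ∈ W} ×ˢ (Set.univ : Set (ℕ → ℝ)) ∪
        (Set.univ : Set (ℕ → V)) ×ˢ {τ : ℕ → ℝ | ¬∀ k, 0 < τ k} := by
    intro ω hω
    by_cases h : ∀ k, 0 < ω.2 k
    · refine Or.inl ⟨fun n => ?_, trivial⟩
      rw [← position_sum h n]
      exact hω _ (Finset.sum_nonneg fun k _ => (h k).le)
    · exact Or.inr ⟨trivial, h⟩
  refine (measure_mono hsub).trans ((measure_union_le _ _).trans ?_)
  rw [walkLaw, Measure.prod_prod, Measure.prod_prod, ae_iff.1 ae_pos_holdingTimes]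
  simp

variable {G}

lemma lintegral_stepLaw [Countable V] {x : V} (hx : 0 < G.degree x) {u : V → ℝ}
    (hu : ∀ y, 0 ≤ u y) : ∫⁻ y, ENNReal.ofReal (u y) ∂stepLaw G x =
      ENNReal.ofReal ((1 / (G.degree x : ℝ)) * ∑ y ∈ G.neighborFinset x, u y) := by
  classical
  have hne : (G.neighborFinset x).Nonempty := by
    rwa [← Finset.card_pos, G.card_neighborFinset_eq_degree]
  rw [stepLaw, dif_pos hne, lintegral_countable', tsum_eq_sum (s := G.neighborFinset x),
    Finset.mul_sum, ENNReal.ofReal_sum_of_nonneg fun y _ => mul_nonneg (by positivity) (hu y)]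
  · refine Finset.sum_congr rfl fun y hy => ?_
    rw [PMF.toMeasure_apply_singleton _ _ (measurableSet_singleton y),
      PMF.uniformOfFinset_apply_of_mem _ hy, mul_comm, ENNReal.ofReal_mul (by positivity), one_div,
      ENNReal.ofReal_inv_of_pos (by exact_mod_cast hx), G.card_neighborFinset_eq_degree,
      ENNReal.ofReal_natCast]
  · intro y hy
    rw [PMF.toMeasure_apply_singleton _ _ (measurableSet_singleton y),
      PMF.uniformOfFinset_apply_of_notMem _ hy, mul_zero]

/-- The Markov property of the jump chain at time `n`. -/
lemma lintegral_jumpChain_succ (x : V) (n : ℕ)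
    {F : ((i : Finset.Iic n) → V) → V → ENNReal} (hF : Measurable (Function.uncurry F)) :
    ∫⁻ ω, F (Preorder.frestrictLe n ω) (ω (n + 1)) ∂jumpChain G x =
      ∫⁻ ω, ∫⁻ y, F (Preorder.frestrictLe n ω) y ∂stepLaw G (ω n) ∂jumpChain G x := by
  have h := Kernel.partialTraj_compProd_eq_map_traj (X := fun _ => V) (κ := jumpKernel G)
    (Nat.zero_le n) (x₀ := fun _ => x)
  have h1 : ∫⁻ ω, F (Preorder.frestrictLe n ω) (ω (n + 1)) ∂jumpChain G x =
      ∫⁻ p, Function.uncurry F p ∂((jumpChain G x).map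
        fun ω => (Preorder.frestrictLe n ω, ω (n + 1))) :=
    (lintegral_map hF ((Preorder.measurable_frestrictLe (X := fun _ => V) n).prodMk
      (measurable_pi_apply _))).symm
  rw [h1, jumpChain, ← h, Measure.lintegral_compProd hF, ← Kernel.traj_map_frestrictLe_apply,
    lintegral_map hF.lintegral_kernel_prod_right'
      (Preorder.measurable_frestrictLe (X := fun _ => V) n)]
  rfl

/-- Expectations of the jump chain at time `n`, killed when it leaves `W`, are iterates of the
killed step. -/
lemma lintegral_jumpChain_killed [Countable V] (hdeg : ∀ x, 0 < G.degree x) (W : Set V) (x : V)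
    (n : ℕ) : ∀ {u : V → ℝ}, (∀ y, 0 ≤ u y) →
      ∫⁻ ω, {ω : ℕ → V | ∀ i ≤ n, ω i ∈ W}.indicator (fun ω => ENNReal.ofReal (u (ω n))) ω
        ∂jumpChain G x = ENNReal.ofReal ((killedStep G W)^[n] (W.indicator u) x) := by
  classical
  induction n with
  | zero =>
    intro u _
    have h0 : Preorder.frestrictLe (π := fun _ => V) 0 = fun ω (i : Finset.Iic 0) => ω i := rfl
    have h1 := Kernel.traj_map_frestrictLe_apply (X := fun _ => V) (κ := jumpKernel G) 0 0
      (fun _ => x)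
    rw [Kernel.partialTraj_self, Kernel.id_apply] at h1
    have hm : Measurable fun p : ((i : Finset.Iic 0) → V) =>
        ENNReal.ofReal (W.indicator u (p ⟨0, by simp⟩)) :=
      (Measurable.of_discrete (f := fun y => ENNReal.ofReal (W.indicator u y))).comp
        (measurable_pi_apply _)
    have h2 := lintegral_map (μ := jumpChain G x) hm
      (Preorder.measurable_frestrictLe (X := fun _ => V) 0)
    rw [jumpChain, h1, lintegral_dirac' _ hm] at h2
    rw [Function.iterate_zero, id, h2]
    refine lintegral_congr fun ω => ?_
    by_cases h : ω 0 ∈ W <;> simp [Set.indicator, h]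
  | succ n ih =>
    intro u hu
    have hW : ∀ y, 0 ≤ W.indicator u y := Set.indicator_nonneg fun y _ => hu y
    set A : Set ((i : Finset.Iic n) → V) := {p | ∀ i, p i ∈ W} with hA
    have hAm : MeasurableSet A := by
      have : A = ⋂ i, (fun p : (i : Finset.Iic n) → V => p i) ⁻¹' W := by ext; simp [hA]
      rw [this]
      exact MeasurableSet.iInter fun i => measurable_pi_apply i (MeasurableSet.of_discrete)
    have hF : Measurable (Function.uncurry fun (p : (i : Finset.Iic n) → V) (y : V) =>
        A.indicator (fun _ => ENNReal.ofReal (W.indicator u y)) p) := by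
      have : (Function.uncurry fun (p : (i : Finset.Iic n) → V) (y : V) =>
          A.indicator (fun _ => ENNReal.ofReal (W.indicator u y)) p) =
          (Prod.fst ⁻¹' A).indicator fun q => ENNReal.ofReal (W.indicator u q.2) := by
        ext ⟨p, y⟩
        by_cases h : p ∈ A <;> simp [h]
      rw [this]
      exact ((Measurable.of_discrete (f := fun y => ENNReal.ofReal (W.indicator u y))).comp
        measurable_snd).indicator (measurable_fst hAm)
    have hmem : ∀ ω : ℕ → V, Preorder.frestrictLe n ω ∈ A ↔ ∀ i ≤ n, ω i ∈ W := by
      intro ω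
      simp [hA]
    have hidem : W.indicator (killedStep G W (W.indicator u)) =
        killedStep G W (W.indicator u) := by
      rw [killedStep, Set.indicator_indicator, Set.inter_self]
    have h1 := lintegral_jumpChain_succ (G := G) x n hF
    have h2 : ∀ ω : ℕ → V, {ω : ℕ → V | ∀ i ≤ n + 1, ω i ∈ W}.indicator
        (fun ω => ENNReal.ofReal (u (ω (n + 1)))) ω =
        A.indicator (fun _ => ENNReal.ofReal (W.indicator u (ω (n + 1))))
          (Preorder.frestrictLe n ω) := by
      intro ω
      have h3 : (∀ i ≤ n + 1, ω i ∈ W) ↔ (∀ i ≤ n, ω i ∈ W) ∧ ω (n + 1) ∈ W :=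
        ⟨fun h => ⟨fun i hi => h i (by omega), h _ le_rfl⟩, fun h i hi => by
          rcases Nat.le_succ_iff.1 hi with h' | h'
          · exact h.1 i h'
          · rw [h']; exact h.2⟩
      simp only [Set.indicator, Set.mem_ofPred_eq, hmem, h3]
      by_cases h4 : ∀ i ≤ n, ω i ∈ W <;> by_cases h5 : ω (n + 1) ∈ W <;> simp [h4, h5]
    rw [lintegral_congr h2, h1, Function.iterate_succ_apply, ← hidem, ← ih (killedStep_nonneg W hW)]
    refine lintegral_congr fun ω => ?_
    by_cases h4 : ∀ i ≤ n, ω i ∈ W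
    · have h5 : ω n ∈ W := h4 n le_rfl
      have h6 : ω ∈ {ω : ℕ → V | ∀ i ≤ n, ω i ∈ W} := h4
      rw [Set.indicator_of_mem h6, killedStep, Set.indicator_of_mem h5,
        ← lintegral_stepLaw (hdeg _) hW]
      simp only [Set.indicator_of_mem ((hmem ω).2 h4)]
    · have h6 : ω ∉ {ω : ℕ → V | ∀ i ≤ n, ω i ∈ W} := h4
      rw [Set.indicator_of_notMem h6]
      simp only [Set.indicator_of_notMem (mt (hmem ω).1 h4), lintegral_zero]

/-- A region in which the walk stays with positive probability carries a nonzero bounded function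
that vanishes outside and is subharmonic: the probability of staying in it. -/
theorem stayProb_eq_zero_of_forall_subharmonic [Countable V] (hdeg : ∀ x, 0 < G.degree x)
    (W : Set V) (h : ∀ u : V → ℝ, (∀ x, 0 ≤ u x) → (∀ x, u x ≤ 1) → (∀ x ∉ W, u x = 0) →
      (∀ x, G.degree x * u x ≤ ∑ y ∈ G.neighborFinset x, u y) → ∀ x, u x = 0) (x : V) :
    stayProb G x W = 0 := by
  set a : ℕ → V → ℝ := fun n => (killedStep G W)^[n] (W.indicator 1) with ha
  have hsucc : ∀ n, a (n + 1) = killedStep G W (a n) := fun n =>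
    Function.iterate_succ_apply' _ _ _
  have ha0 : ∀ n x, 0 ≤ a n x := by
    intro n
    induction n with
    | zero => exact Set.indicator_nonneg fun _ _ => zero_le_one
    | succ n ih => rw [hsucc]; exact killedStep_nonneg W ih
  have hmono : ∀ {u v : V → ℝ}, (∀ x, u x ≤ v x) → ∀ x, killedStep G W u x ≤ killedStep G W v x :=
    fun huv x => Set.indicator_le_indicator (mul_le_mul_of_nonneg_left
      (Finset.sum_le_sum fun y _ => huv y) (by positivity))
  have ha1 : ∀ x, a 0 x ≤ 1 := fun x => Set.indicator_le_self' (fun _ _ => zero_le_one) x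
  have hanti : ∀ n x, a (n + 1) x ≤ a n x := by
    intro n
    induction n with
    | zero =>
      intro x
      rw [hsucc]
      refine Set.indicator_le_indicator ?_
      have hd : (0 : ℝ) < G.degree x := by exact_mod_cast hdeg x
      rw [one_div, inv_mul_le_iff₀ hd, Pi.one_apply, mul_one]
      refine (Finset.sum_le_card_nsmul _ _ 1 fun y _ => ha1 y).trans (by simp)
    | succ n ih =>
      intro x
      rw [hsucc (n + 1)]
      exact (hmono ih x).trans_eq (congrFun (hsucc n) x).symm
  have hanti' : ∀ x, Antitone fun n => a n x := fun x => antitone_nat_of_succ_le fun n => hanti n x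
  have hbdd : ∀ x, BddBelow (Set.range fun n => a n x) := fun x =>
    ⟨0, by rintro _ ⟨n, rfl⟩; exact ha0 n x⟩
  have hlim : ∀ x, Tendsto (fun n => a n x) atTop (𝓝 (⨅ n, a n x)) := fun x =>
    tendsto_atTop_ciInf (hanti' x) (hbdd x)
  have hzero := h (fun x => ⨅ n, a n x) (fun x => Real.iInf_nonneg fun n => ha0 n x)
    (fun x => (ciInf_le (hbdd x) 0).trans (ha1 x))
    (fun x hx => le_antisymm ((ciInf_le (hbdd x) 0).trans_eq (Set.indicator_of_notMem hx _))
      (Real.iInf_nonneg fun n => ha0 n x)) fun x => by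
      by_cases hx : x ∈ W
      · refine le_of_tendsto_of_tendsto' (((hlim x).comp (tendsto_add_atTop_nat 1)).const_mul _)
          (tendsto_finsetSum _ fun y _ => hlim y) fun n => ?_
        have hd : (G.degree x : ℝ) ≠ 0 := by exact_mod_cast (hdeg x).ne'
        rw [Function.comp_apply, hsucc, killedStep, Set.indicator_of_mem hx, one_div,
          mul_inv_cancel_left₀ hd]
      · have h0 : ⨅ n, a n x = 0 := le_antisymm
          ((ciInf_le (hbdd x) 0).trans_eq (Set.indicator_of_notMem hx _))
          (Real.iInf_nonneg fun n => ha0 n x)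
        rw [h0, mul_zero]
        exact Finset.sum_nonneg fun y _ => Real.iInf_nonneg fun n => ha0 n y
  have hle : ∀ n, stayProb G x W ≤ ENNReal.ofReal (a n x) := by
    intro n
    refine (stayProb_le_jumpChain G x W).trans ?_
    rw [← lintegral_jumpChain_killed hdeg W x n (u := 1) fun _ => zero_le_one]
    have hm : MeasurableSet {ω : ℕ → V | ∀ i ≤ n, ω i ∈ W} := by
      have : {ω : ℕ → V | ∀ i ≤ n, ω i ∈ W} = ⋂ i, ⋂ (_ : i ≤ n), (fun ω => ω i) ⁻¹' W := by
        ext; simp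
      rw [this]
      exact MeasurableSet.iInter fun i => MeasurableSet.iInter fun _ =>
        measurable_pi_apply i MeasurableSet.of_discrete
    simp only [Pi.one_apply, ENNReal.ofReal_one]
    rw [lintegral_indicator_const hm, one_mul]
    exact measure_mono fun ω hω i _ => hω i
  have h0 : Tendsto (fun n => ENNReal.ofReal (a n x)) atTop (𝓝 0) := by
    have := ENNReal.tendsto_ofReal (hlim x)
    rwa [hzero x, ENNReal.ofReal_zero] at this
  exact le_antisymm (ge_of_tendsto' h0 hle) zero_le

end Stay

/-! ### Neighbours in the paired trees -/

section Tree

variable {b L : ℕ → ℕ}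

instance (k : ℕ) : Finite (Gen b k) := by
  induction k with
  | zero => exact Finite.of_surjective (fun _ : Unit => Gen.root) fun g => ⟨(), by cases g; rfl⟩
  | succ k ih =>
    exact Finite.of_surjective (fun p : Gen b k × Fin (b k) => p.1.child p.2) fun g => by
      cases g with | child g a => exact ⟨(g, a), rfl⟩

instance : Countable (Vertex b) :=
  Function.Injective.countable (f := fun x : Vertex b => (⟨x.generation, x.point⟩ : Σ k, Gen b k))
    fun x y h => by cases x; cases y; cases h; rfl

lemma finite_setOf_generation_le (m : ℕ) : {x : Vertex b | x.generation ≤ m}.Finite := by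
  refine ((Set.finite_Iic m).biUnion fun k _ => Set.finite_range (Vertex.mk (b := b) k)).subset ?_
  intro x hx
  exact Set.mem_biUnion (Set.mem_Iic.2 hx) ⟨x.point, rfl⟩

lemma child_injective {k : ℕ} (g : Gen b k) : Function.Injective (child g) := by
  intro a a' h
  cases h
  rfl

lemma exists_eq_root_or_child (x : Vertex b) :
    x = ⟨0, Gen.root⟩ ∨ ∃ (k : ℕ) (g : Gen b k) (a : Fin (b k)), x = child g a := by
  obtain ⟨k, g⟩ := x
  cases g with
  | root => exact Or.inl rfl
  | child g a => exact Or.inr ⟨_, g, a, rfl⟩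

lemma treeGraph_adj_child {k : ℕ} (g : Gen b k) (a : Fin (b k)) :
    (treeGraph b).Adj ⟨k, g⟩ (child g a) := by
  refine (SimpleGraph.fromRel_adj _ _ _).2 ⟨fun h => ?_, Or.inl ⟨k, g, a, rfl, rfl⟩⟩
  have := congrArg Vertex.generation h
  simp [child] at this

/-- The other member of the pair of `a`, among an even number of siblings. -/
def partner {n : ℕ} (hn : Even n) (a : Fin n) : Fin n :=
  ⟨if Even (a : ℕ) then a + 1 else a - 1, by
    have := a.2
    rw [Nat.even_iff] at hn
    split_ifs with h
    · rw [Nat.even_iff] at h; omega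
    · omega⟩

lemma partner_partner {n : ℕ} (hn : Even n) : Function.Involutive (partner hn) := by
  intro a
  ext
  simp only [partner]
  by_cases h : Even (a : ℕ)
  · simp [h, Nat.even_add_one]
  · have h2 : Even ((a : ℕ) - 1) := by
      rw [Nat.even_iff] at h ⊢; omega
    have h3 : 0 < (a : ℕ) := by
      rw [Nat.even_iff] at h; omega
    simp [h, h2]
    omega

lemma partner_ne {n : ℕ} (hn : Even n) (a : Fin n) : partner hn a ≠ a := by
  intro h
  have h' := congrArg Fin.val h
  simp only [partner] at h'
  split_ifs at h' with h1
  · omega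
  · rw [Nat.even_iff] at h1; omega

lemma pairGraph_adj_child_iff {k : ℕ} (hb : Even (b k)) (g : Gen b k) (a : Fin (b k))
    (y : Vertex b) : (pairGraph b L).Adj (child g a) y ↔
      k + 1 ∈ Set.range L ∧ y = child g (partner hb a) := by
  rw [pairGraph, SimpleGraph.fromRel_adj]
  constructor
  · rintro ⟨-, ⟨k', g', a', a'', hL, he, hs, h1, rfl⟩ | ⟨k', g', a', a'', hL, he, hs, rfl, h1⟩⟩
    · cases h1
      refine ⟨hL, congrArg _ (Fin.ext ?_)⟩
      simp [partner, he, hs]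
    · cases h1
      refine ⟨hL, congrArg _ (Fin.ext ?_)⟩
      have : ¬Even (a : ℕ) := by rw [hs, Nat.even_add_one]; simpa using he
      simp only [partner, this, if_false]
      omega
  · rintro ⟨hL, rfl⟩
    refine ⟨fun h => partner_ne hb a (child_injective g h).symm, ?_⟩
    by_cases he : Even (a : ℕ)
    · exact Or.inl ⟨k, g, a, partner hb a, hL, he, by simp [partner, he], rfl, rfl⟩
    · have h1 : Even ((a : ℕ) - 1) ∧ 0 < (a : ℕ) := by
        rw [Nat.even_iff] at he ⊢; omega
      refine Or.inr ⟨k, g, partner hb a, a, hL, ?_, ?_, rfl, rfl⟩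
      · simp [partner, he, h1.1]
      · simp only [partner, he, if_false]; omega

lemma generation_eq_of_pairGraph_adj {x y : Vertex b} (h : (pairGraph b L).Adj x y) :
    x.generation = y.generation := by
  rw [pairGraph, SimpleGraph.fromRel_adj] at h
  rcases h with ⟨-, ⟨k, g, a, a', -, -, -, rfl, rfl⟩ | ⟨k, g, a, a', -, -, -, rfl, rfl⟩⟩ <;> rfl

lemma pairedTree_adj_root_iff (y : Vertex b) :
    (pairedTree b L).Adj ⟨0, Gen.root⟩ y ↔ ∃ a, y = child Gen.root a := by
  rw [pairedTree, SimpleGraph.sup_adj]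
  constructor
  · rintro (h | h)
    · rw [treeGraph, SimpleGraph.fromRel_adj] at h
      rcases h with ⟨-, ⟨k, g, a, h1, rfl⟩ | ⟨k, g, a, rfl, h1⟩⟩
      · cases h1; exact ⟨a, rfl⟩
      · cases h1
    · rw [pairGraph, SimpleGraph.fromRel_adj] at h
      rcases h with ⟨-, ⟨k, g, a, a', -, -, -, h1, -⟩ | ⟨k, g, a, a', -, -, -, -, h1⟩⟩ <;> cases h1
  · rintro ⟨a, rfl⟩
    exact Or.inl (treeGraph_adj_child _ a)

lemma pairedTree_adj_child_iff {k : ℕ} (hb : Even (b k)) (g : Gen b k) (a : Fin (b k))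
    (y : Vertex b) : (pairedTree b L).Adj (child g a) y ↔ y = ⟨k, g⟩ ∨
      (k + 1 ∈ Set.range L ∧ y = child g (partner hb a)) ∨ ∃ a', y = child (g.child a) a' := by
  rw [pairedTree, SimpleGraph.sup_adj, pairGraph_adj_child_iff hb]
  constructor
  · rintro (h | h)
    · rw [treeGraph, SimpleGraph.fromRel_adj] at h
      rcases h with ⟨-, ⟨k', g', a', h1, rfl⟩ | ⟨k', g', a', rfl, h1⟩⟩
      · cases h1; exact Or.inr (Or.inr ⟨a', rfl⟩)
      · cases h1; exact Or.inl rfl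
    · exact Or.inr (Or.inl h)
  · rintro (rfl | h | ⟨a', rfl⟩)
    · exact Or.inl (treeGraph_adj_child g a).symm
    · exact Or.inr h
    · exact Or.inl (treeGraph_adj_child (g.child a) a')

lemma pairedSign_child (b L : ℕ → ℕ) {k : ℕ} (g : Gen b k) (a : Fin (b k)) :
    pairedSign b L s(⟨k, g⟩, child g a) = 1 := by
  rw [pairedSign, if_neg]
  intro h
  have := generation_eq_of_pairGraph_adj ((SimpleGraph.mem_edgeSet _).1 h)
  simp [child] at this

lemma pairedSign_partner {k : ℕ} (hb : Even (b k)) (hL : k + 1 ∈ Set.range L) (g : Gen b k)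
    (a : Fin (b k)) : pairedSign b L s(child g a, child g (partner hb a)) = -1 := by
  rw [pairedSign, if_pos]
  exact (SimpleGraph.mem_edgeSet _).2 ((pairGraph_adj_child_iff hb g a _).2 ⟨hL, rfl⟩)

lemma finite_neighborSet_pairedTree (hb : ∀ k, Even (b k)) (x : Vertex b) :
    ((pairedTree b L).neighborSet x).Finite := by
  refine (finite_setOf_generation_le (x.generation + 1)).subset fun y hy => ?_
  rw [SimpleGraph.mem_neighborSet] at hy
  rcases exists_eq_root_or_child x with rfl | ⟨k, g, a, rfl⟩
  · obtain ⟨a, rfl⟩ := (pairedTree_adj_root_iff y).1 hy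
    simp [child]
  · rcases (pairedTree_adj_child_iff (hb k) g a y).1 hy with rfl | ⟨-, rfl⟩ | ⟨a', rfl⟩ <;>
      simp [child]
    omega

lemma pairedTree_connected (b L : ℕ → ℕ) : (pairedTree b L).Connected := by
  have h : ∀ (k : ℕ) (g : Gen b k), (pairedTree b L).Reachable ⟨0, Gen.root⟩ ⟨k, g⟩ := by
    intro k g
    induction g with
    | root => rfl
    | child g a ih => exact ih.trans (SimpleGraph.Adj.reachable (Or.inl (treeGraph_adj_child g a)))
  have : Nonempty (Vertex b) := ⟨⟨0, Gen.root⟩⟩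
  exact ⟨fun x y => (h _ x.point).symm.trans (h _ y.point)⟩

variable [(pairedTree b L).LocallyFinite]

lemma sum_neighborFinset_root (f : Vertex b → ℝ) :
    ∑ y ∈ (pairedTree b L).neighborFinset ⟨0, Gen.root⟩, f y = ∑ a, f (child Gen.root a) := by
  have h : (pairedTree b L).neighborFinset ⟨0, Gen.root⟩ =
      Finset.univ.map ⟨child Gen.root, child_injective Gen.root⟩ := by
    ext y
    rw [SimpleGraph.mem_neighborFinset, pairedTree_adj_root_iff]
    simp [eq_comm]
  rw [h, Finset.sum_map]
  rfl

open Classical in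
lemma sum_neighborFinset_child {k : ℕ} (hb : Even (b k)) (g : Gen b k) (a : Fin (b k))
    (f : Vertex b → ℝ) :
    ∑ y ∈ (pairedTree b L).neighborFinset (child g a), f y = f ⟨k, g⟩ +
      (if k + 1 ∈ Set.range L then f (child g (partner hb a)) else 0) +
        ∑ a', f (child (g.child a) a') := by
  set B : Finset (Vertex b) := if k + 1 ∈ Set.range L then {child g (partner hb a)} else ∅ with hB
  set C : Finset (Vertex b) :=
    Finset.univ.map ⟨child (g.child a), child_injective (g.child a)⟩ with hC
  have hBmem : ∀ y, y ∈ B ↔ k + 1 ∈ Set.range L ∧ y = child g (partner hb a) := by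
    intro y
    rw [hB]
    split_ifs with h <;> simp [h]
  have hCmem : ∀ y, y ∈ C ↔ ∃ a', y = child (g.child a) a' := by
    intro y
    simp [hC, eq_comm]
  have hBC : Disjoint B C := by
    refine Finset.disjoint_left.2 fun y hy hy' => ?_
    obtain ⟨-, rfl⟩ := (hBmem y).1 hy
    obtain ⟨a', h⟩ := (hCmem _).1 hy'
    have := congrArg Vertex.generation h
    simp [child] at this
  have hx : (⟨k, g⟩ : Vertex b) ∉ B ∪ C := by
    intro h
    rcases Finset.mem_union.1 h with h | h
    · have := congrArg Vertex.generation ((hBmem _).1 h).2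
      simp [child] at this
    · obtain ⟨a', h⟩ := (hCmem _).1 h
      have := congrArg Vertex.generation h
      simp only [child] at this
      omega
  have h : (pairedTree b L).neighborFinset (child g a) = insert ⟨k, g⟩ (B ∪ C) := by
    ext y
    rw [SimpleGraph.mem_neighborFinset, pairedTree_adj_child_iff hb, Finset.mem_insert,
      Finset.mem_union, hBmem, hCmem]
  rw [h, Finset.sum_insert hx, Finset.sum_union hBC, hC, Finset.sum_map, add_assoc, hB]
  congr 2
  split_ifs <;> simp

lemma degree_root : (((pairedTree b L).degree ⟨0, Gen.root⟩ : ℕ) : ℝ) = b 0 := by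
  have h := sum_neighborFinset_root (b := b) (L := L) fun _ => 1
  simpa using h

open Classical in
lemma degree_child {k : ℕ} (hb : Even (b k)) (g : Gen b k) (a : Fin (b k)) :
    (((pairedTree b L).degree (child g a) : ℕ) : ℝ) =
      1 + (if k + 1 ∈ Set.range L then 1 else 0) + b (k + 1) := by
  have h := sum_neighborFinset_child (L := L) hb g a fun _ => 1
  simpa using h

end Tree

/-! ### Two equilibria on the paired trees -/

section Numeric

/-- The decrease of the radial supersolution with source `2 * c` between the generations `m` and
`m + 1`, on a tree in which every vertex of generation `m` has `b m` children. -/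
noncomputable def decrement (b : ℕ → ℕ) (c : ℕ → ℝ) : ℕ → ℝ
  | 0 => 0
  | m + 1 => (decrement b c m + 2 * c (m + 1)) / b (m + 1)

variable {b : ℕ → ℕ} {c : ℕ → ℝ}

lemma decrement_nonneg (hc : ∀ m, 0 ≤ c m) (m : ℕ) : 0 ≤ decrement b c m := by
  induction m with
  | zero => exact le_rfl
  | succ m ih =>
    have := hc (m + 1)
    rw [decrement]
    positivity

lemma summable_decrement (hb : ∀ m, 2 ≤ b m) (hc : ∀ m, 0 ≤ c m)
    (hs : Summable fun m => c m / b m) : Summable (decrement b c) := by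
  have hb' : ∀ m, (2 : ℝ) ≤ b m := fun m => by exact_mod_cast hb m
  have hc' : ∀ m, 0 ≤ c m / b m := fun m => div_nonneg (hc m) (by positivity)
  set E := ∑' m, c m / b m with hE
  refine summable_of_sum_range_le (c := 4 * E) (decrement_nonneg hc) fun n => ?_
  induction n with
  | zero => simpa using tsum_nonneg hc'
  | succ n ih =>
    rw [Finset.sum_range_succ', decrement, add_zero]
    have h1 : ∀ m ∈ Finset.range n, decrement b c (m + 1) ≤
        decrement b c m / 2 + 2 * (c (m + 1) / b (m + 1)) := by
      intro m _
      rw [decrement, add_div, mul_div_assoc]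
      have := decrement_nonneg (b := b) hc m
      have := hb' (m + 1)
      gcongr
    have h2 : ∑ m ∈ Finset.range n, c (m + 1) / b (m + 1) ≤ E := by
      have := hs.sum_le_tsum (Finset.range (n + 1)) fun m _ => hc' m
      rw [Finset.sum_range_succ'] at this
      linarith [hc' 0]
    refine (Finset.sum_le_sum h1).trans ?_
    rw [Finset.sum_add_distrib, ← Finset.sum_div, ← Finset.mul_sum]
    linarith

/-- A radial supersolution on a tree with `b m ≥ 2` children in generation `m`, with a source of
size `2 * c m`; it is as small as desired far from the root. -/
lemma exists_radial_supersolution (hb : ∀ m, 2 ≤ b m) (hc : ∀ m, 0 ≤ c m)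
    (hs : Summable fun m => c m / b m) : ∃ g : ℕ → ℝ, (∀ m, 0 ≤ g m) ∧ g 1 ≤ g 0 ∧
      (∀ m, g m + 2 * c (m + 1) + b (m + 1) * g (m + 2) ≤ (1 + b (m + 1)) * g (m + 1)) ∧
      ∃ m, g m < 1 := by
  have hsum := summable_decrement hb hc hs
  have hstep : ∀ m, ∑' j, decrement b c (j + m) =
      decrement b c m + ∑' j, decrement b c (j + (m + 1)) := by
    intro m
    rw [((summable_nat_add_iff m).2 hsum).tsum_eq_zero_add, zero_add]
    congr 1
    refine tsum_congr fun j => ?_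
    rw [add_right_comm, add_assoc]
  refine ⟨fun m => ∑' j, decrement b c (j + m), fun m => tsum_nonneg fun j =>
    decrement_nonneg hc _, ?_, fun m => ?_, ?_⟩
  · have := hstep 0
    have h0 : decrement b c 0 = 0 := rfl
    linarith
  · have h1 := hstep m
    have h2 := hstep (m + 1)
    have hpos : (b (m + 1) : ℝ) ≠ 0 := by
      have := hb (m + 1)
      positivity
    have h3 : b (m + 1) * decrement b c (m + 1) = decrement b c m + 2 * c (m + 1) := by
      rw [decrement, mul_div_cancel₀ _ hpos]
    have h4 : (b (m + 1) : ℝ) * ∑' j, decrement b c (j + (m + 1)) = b (m + 1) *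
        decrement b c (m + 1) + b (m + 1) * ∑' j, decrement b c (j + (m + 1 + 1)) := by
      rw [h2]; ring
    simp only
    change ∑' j, decrement b c (j + m) + 2 * c (m + 1) +
      b (m + 1) * ∑' j, decrement b c (j + (m + 1 + 1)) ≤ _
    linarith
  · exact ((tendsto_sum_nat_add (decrement b c)).eventually (gt_mem_nhds one_pos)).exists

end Numeric

section Paired

variable {b L : ℕ → ℕ}

lemma IsAdmissible.two_le (h : IsAdmissible b L) (m : ℕ) : 2 ≤ b m := by
  have h1 := h.pos m
  have h2 := Nat.even_iff.1 (h.even m)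
  omega

/-- A father and a pair of his children form an unsatisfied triangle. -/
lemma IsAdmissible.regionHasUnsatisfiedCycle (h : IsAdmissible b L) {W : Set (Vertex b)} {m : ℕ}
    (hm : m + 1 ∈ Set.range L) {g : Gen b m} {a : Fin (b m)} (h0 : ⟨m, g⟩ ∈ W)
    (h1 : child g a ∈ W) (h2 : child g (partner (h.even m) a) ∈ W) :
    RegionHasUnsatisfiedCycle (pairedTree b L) (pairedSign b L) W := by
  have e01 : ((pairedTree b L).induce W).Adj ⟨_, h0⟩ ⟨_, h1⟩ := Or.inl (treeGraph_adj_child g a)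
  have e12 : ((pairedTree b L).induce W).Adj ⟨_, h1⟩ ⟨_, h2⟩ :=
    Or.inr ((pairGraph_adj_child_iff (h.even m) g a _).2 ⟨hm, rfl⟩)
  have e20 : ((pairedTree b L).induce W).Adj ⟨_, h2⟩ ⟨_, h0⟩ :=
    Or.inl (treeGraph_adj_child g (partner (h.even m) a)).symm
  refine ⟨_, .cons e01 (.cons e12 (.cons e20 .nil)), ?_, ?_⟩
  · rw [SimpleGraph.Walk.cons_isCycle_iff]
    have n01 := e01.ne
    have n12 := e12.ne
    have n20 := e20.ne
    simp only [ne_eq, Subtype.mk.injEq] at n01 n12 n20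
    simp [n01, n12, n20, Ne.symm n01, Ne.symm n20]
  · simp only [walkSign, SimpleGraph.Walk.edges_cons, SimpleGraph.Walk.edges_nil, List.map_cons,
      List.map_nil, Sym2.map_mk, List.prod_cons, List.prod_nil]
    rw [pairedSign_child, pairedSign_partner (h.even m) hm, Sym2.eq_swap, pairedSign_child]
    simp

variable [(pairedTree b L).LocallyFinite]

lemma IsAdmissible.degree_pos (h : IsAdmissible b L) (x : Vertex b) :
    0 < (pairedTree b L).degree x := by
  have hR : (0 : ℝ) < (pairedTree b L).degree x := by
    rcases exists_eq_root_or_child x with rfl | ⟨k, g, a, rfl⟩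
    · rw [degree_root]
      exact_mod_cast h.pos 0
    · rw [degree_child (h.even k)]
      split_ifs <;> positivity
  exact_mod_cast hR

/-- The walk crosses extra edges of generation `L n` with probability of order at most `2 ^ (-n)`,
so that far from the root it is unlikely ever to cross one. -/
theorem IsAdmissible.hasMultipleEquilibria (h : IsAdmissible b L) :
    HasMultipleEquilibria (pairedTree b L) (pairedSign b L) := by
  classical
  set c : ℕ → ℝ := fun m => if m ∈ Set.range L then 1 else 0 with hc
  have hc0 : ∀ m, 0 ≤ c m := fun m => by simp only [hc]; split_ifs <;> simp
  have hs : Summable fun m => c m / b m := by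
    refine (h.strictMono.injective.summable_iff fun m hm => by
      simp only [hc, if_neg hm, zero_div]).1 ?_
    refine Summable.of_nonneg_of_le (fun n => div_nonneg (hc0 _) (by positivity)) (fun n => ?_)
      summable_geometric_two
    have h1 : (2 : ℝ) ^ n ≤ b (L n) := by exact_mod_cast h.sparse n
    have h2 : c (L n) = 1 := if_pos ⟨n, rfl⟩
    rw [Function.comp_apply, h2, one_div_pow]
    gcongr
  obtain ⟨g, hg0, hg1, hg2, m, hm⟩ := exists_radial_supersolution h.two_le hc0 hs
  have hne : ∀ k, Nonempty (Gen b k) := by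
    intro k
    induction k with
    | zero => exact ⟨Gen.root⟩
    | succ k ih => exact ⟨ih.some.child ⟨0, h.pos k⟩⟩
  refine hasMultipleEquilibria_of_supersolution h.degree_pos (g := fun x => g x.generation)
    (fun x => hg0 _) (fun x => ?_) (x := ⟨m, (hne m).some⟩) hm
  rcases exists_eq_root_or_child x with rfl | ⟨k, p, a, rfl⟩
  · rw [sum_neighborFinset_root, degree_root]
    have h1 : ∀ a : Fin (b 0), g (child (Gen.root : Gen b 0) a).generation +
        (1 - ((pairedSign b L s(⟨0, Gen.root⟩, child Gen.root a) : ℤ) : ℝ)) = g 1 := by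
      intro a
      rw [pairedSign_child]
      simp [child]
    rw [Finset.sum_congr rfl fun a _ => h1 a]
    simp only [Finset.sum_const, Finset.card_univ, Fintype.card_fin, nsmul_eq_mul]
    gcongr
  · rw [sum_neighborFinset_child (h.even k), degree_child (h.even k)]
    have h1 : ∀ a' : Fin (b (k + 1)), g (child (p.child a) a').generation +
        (1 - ((pairedSign b L s(child p a, child (p.child a) a') : ℤ) : ℝ)) = g (k + 2) := by
      intro a'
      have h2 := pairedSign_child b L (p.child a) a'
      change pairedSign b L s(child p a, child (p.child a) a') = 1 at h2
      rw [h2]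
      simp [child]
    rw [Finset.sum_congr rfl fun a _ => h1 a, Sym2.eq_swap, pairedSign_child]
    simp only [Finset.sum_const, Finset.card_univ, Fintype.card_fin, nsmul_eq_mul]
    have h3 := hg2 k
    by_cases hL : k + 1 ∈ Set.range L
    · have h4 : c (k + 1) = 1 := if_pos hL
      rw [if_pos hL, if_pos hL, pairedSign_partner (h.even k) hL]
      rw [h4] at h3
      simp only [child]
      push_cast
      linarith
    · have h4 : c (k + 1) = 0 := if_neg hL
      rw [if_neg hL, if_neg hL]
      rw [h4] at h3
      simp only [child]
      push_cast
      linarith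

/-! ### No region without unsatisfied cycles retains the walk -/

/-- The maximum principle in the ball of radius `m`: a subharmonic function is dominated by its
values on the sphere. -/
lemma IsAdmissible.exists_generation_eq_and_le (h : IsAdmissible b L) {u : Vertex b → ℝ}
    (hu : ∀ x, (pairedTree b L).degree x * u x ≤ ∑ y ∈ (pairedTree b L).neighborFinset x, u y)
    (m : ℕ) : ∀ x : Vertex b, x.generation ≤ m → ∃ g : Gen b m, u x ≤ u ⟨m, g⟩ := by
  classical
  induction m with
  | zero =>
    rintro ⟨k, g⟩ hx
    obtain rfl : k = 0 := Nat.le_zero.1 hx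
    exact ⟨g, le_rfl⟩
  | succ m ih =>
    intro x hx
    rcases Nat.le_succ_iff.1 hx with hx | hx
    · obtain ⟨g₀, hg₀⟩ := ih x hx
      have : Nonempty (Gen b m) := ⟨g₀⟩
      obtain ⟨g, hg⟩ := Finite.exists_max fun g : Gen b m => u ⟨m, g⟩
      have hmax : ∀ y : Vertex b, y.generation ≤ m → u y ≤ u ⟨m, g⟩ := fun y hy => by
        obtain ⟨g', hg'⟩ := ih y hy
        exact hg'.trans (hg g')
      -- All neighbours of a maximum point on the sphere other than its children lie in the ball,
      -- so that the average over the children is at least the maximum.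
      have hsum : ∑ _a : Fin (b m), u ⟨m, g⟩ ≤ ∑ a, u (child g a) := by
        have h1 := hu ⟨m, g⟩
        simp only [Finset.sum_const, Finset.card_univ, Fintype.card_fin, nsmul_eq_mul]
        cases g with
        | root => rwa [sum_neighborFinset_root, degree_root] at h1
        | @child k g' a =>
          change (pairedTree b L).degree (child g' a) * u (child g' a) ≤
            ∑ y ∈ (pairedTree b L).neighborFinset (child g' a), u y at h1
          rw [sum_neighborFinset_child (h.even k), degree_child (h.even k)] at h1
          have h2 := hmax ⟨k, g'⟩ (Nat.le_succ k)
          have h3 := hmax (child g' (partner (h.even k) a)) le_rfl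
          change _ ≤ u (child g' a) at h2 h3
          change _ * u (child g' a) ≤ _
          split_ifs at h1 <;> linarith
      have hne : (Finset.univ : Finset (Fin (b m))).Nonempty := ⟨⟨0, h.pos m⟩, Finset.mem_univ _⟩
      obtain ⟨a, -, ha⟩ := Finset.exists_le_of_sum_le hne hsum
      exact ⟨g.child a, hg₀.trans ((hg g₀).trans ha)⟩
    · obtain ⟨k, g⟩ := x
      obtain rfl : k = m + 1 := hx
      exact ⟨g, le_rfl⟩

/-- A father in a generation just above a paired one loses at least a quarter of the bound: in
each pair of his children at most one belongs to the region. -/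
lemma IsAdmissible.le_three_quarters (h : IsAdmissible b L) {W : Set (Vertex b)}
    (hW : ¬RegionHasUnsatisfiedCycle (pairedTree b L) (pairedSign b L) W)
    {u : Vertex b → ℝ} {M : ℝ} (hM0 : 0 ≤ M) (huM : ∀ x, u x ≤ M) (huW : ∀ x ∉ W, u x = 0)
    (hu : ∀ x, (pairedTree b L).degree x * u x ≤ ∑ y ∈ (pairedTree b L).neighborFinset x, u y)
    {m : ℕ} (hm : m + 1 ∈ Set.range L) (g : Gen b m) : u ⟨m, g⟩ ≤ 3 / 4 * M := by
  classical
  by_cases hgW : (⟨m, g⟩ : Vertex b) ∈ W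
  swap
  · rw [huW _ hgW]
    positivity
  have hpair : ∀ a, u (child g a) + u (child g (partner (h.even m) a)) ≤ M := by
    intro a
    by_cases h1 : child g a ∈ W
    · by_cases h2 : child g (partner (h.even m) a) ∈ W
      · exact absurd (h.regionHasUnsatisfiedCycle hm hgW h1 h2) hW
      · rw [huW _ h2, add_zero]
        exact huM _
    · rw [huW _ h1, zero_add]
      exact huM _
  have hsum : 2 * ∑ a, u (child g a) ≤ b m * M := by
    have h1 : ∑ a, u (child g (partner (h.even m) a)) = ∑ a, u (child g a) :=
      Equiv.sum_comp (partner_partner (h.even m)).toPerm fun a => u (child g a)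
    have h2 := Finset.sum_le_sum fun a (_ : a ∈ Finset.univ) => hpair a
    rw [Finset.sum_add_distrib, h1] at h2
    simp only [Finset.sum_const, Finset.card_univ, Fintype.card_fin, nsmul_eq_mul] at h2
    linarith
  have hb2 : (2 : ℝ) ≤ b m := by exact_mod_cast h.two_le m
  have h1 := hu ⟨m, g⟩
  have hbM : 0 ≤ ((b m : ℝ) - 2) * M := mul_nonneg (by linarith) hM0
  cases g with
  | root =>
    rw [sum_neighborFinset_root, degree_root] at h1
    refine le_of_mul_le_mul_left ?_ (by linarith : (0 : ℝ) < b 0)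
    nlinarith
  | @child k g' a =>
    change (pairedTree b L).degree (child g' a) * u (child g' a) ≤
      ∑ y ∈ (pairedTree b L).neighborFinset (child g' a), u y at h1
    rw [sum_neighborFinset_child (h.even k), degree_child (h.even k)] at h1
    have h2 := huM ⟨k, g'⟩
    have h3 := huM (child g' (partner (h.even k) a))
    change u (child g' a) ≤ _
    refine le_of_mul_le_mul_left (a := 1 + (if k + 1 ∈ Set.range L then (1 : ℝ) else 0) +
      b (k + 1)) (h1.trans ?_) (by split_ifs <;> positivity)
    split_ifs <;> linarith

theorem IsAdmissible.stayProb_eq_zero (h : IsAdmissible b L) {W : Set (Vertex b)}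
    (hW : ¬RegionHasUnsatisfiedCycle (pairedTree b L) (pairedSign b L) W) (x : Vertex b) :
    stayProb (pairedTree b L) x W = 0 := by
  refine stayProb_eq_zero_of_forall_subharmonic h.degree_pos W (fun u hu0 hu1 huW hu => ?_) x
  have : Nonempty (Vertex b) := ⟨⟨0, Gen.root⟩⟩
  have hbdd : BddAbove (Set.range u) := ⟨1, by rintro _ ⟨y, rfl⟩; exact hu1 y⟩
  have hM0 : 0 ≤ ⨆ y, u y := (hu0 x).trans (le_ciSup hbdd x)
  have hle : ∀ y, u y ≤ 3 / 4 * ⨆ y, u y := by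
    intro y
    have hL := h.strictMono.le_apply (x := y.generation + 1)
    obtain ⟨m, hm⟩ : ∃ m, L (y.generation + 1) = m + 1 :=
      Nat.exists_eq_add_of_lt (by omega : 0 < L (y.generation + 1)) |>.imp fun m hm => by omega
    obtain ⟨g, hg⟩ := h.exists_generation_eq_and_le hu m y (by omega)
    exact hg.trans (h.le_three_quarters hW hM0 (le_ciSup hbdd) huW hu ⟨_, hm⟩ g)
  have hM := ciSup_le hle
  intro y
  exact le_antisymm ((le_ciSup hbdd y).trans (by linarith)) (hu0 y)

end Paired

lemma isAdmissible_two_pow : IsAdmissible (fun i => 2 ^ (i + 1)) fun n => n + 1 where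
  pos i := by positivity
  even i := ⟨2 ^ i, by rw [pow_succ]; ring⟩
  tendsto := (tendsto_pow_atTop_atTop_of_one_lt one_lt_two).comp (tendsto_add_atTop_nat 1)
  strictMono := strictMono_nat_of_lt_succ fun n => by simp
  one_le n := by simp
  sparse n := Nat.pow_le_pow_right two_pos (by omega)

end SignedVoter

theorem mainTheorem4 :
    (∃ (V : Type) (_ : MeasurableSpace V) (_ : DiscreteMeasurableSpace V)
      (G : SimpleGraph V) (_ : G.LocallyFinite) (s : Sym2 V → ℤˣ),
      G.Connected ∧ SignedVoter.HasMultipleEquilibria G s ∧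
        ¬ ∃ W : Set V, ¬ SignedVoter.RegionHasUnsatisfiedCycle G s W ∧
          ∃ x : V, 0 < SignedVoter.stayProb G x W) ∧
    (∀ b L : ℕ → ℕ, SignedVoter.IsAdmissible b L →
      ∃ _ : (SignedVoter.pairedTree b L).LocallyFinite,
        (SignedVoter.pairedTree b L).Connected ∧
        SignedVoter.HasMultipleEquilibria (SignedVoter.pairedTree b L)
          (SignedVoter.pairedSign b L) ∧
        ¬ ∃ W : Set (SignedVoter.Vertex b),
          ¬ SignedVoter.RegionHasUnsatisfiedCycle (SignedVoter.pairedTree b L)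
            (SignedVoter.pairedSign b L) W ∧
          ∃ x, 0 < SignedVoter.stayProb (SignedVoter.pairedTree b L) x W) := by
  have main : ∀ b L : ℕ → ℕ, SignedVoter.IsAdmissible b L →
      ∃ _ : (SignedVoter.pairedTree b L).LocallyFinite,
        (SignedVoter.pairedTree b L).Connected ∧
        SignedVoter.HasMultipleEquilibria (SignedVoter.pairedTree b L)
          (SignedVoter.pairedSign b L) ∧
        ¬ ∃ W : Set (SignedVoter.Vertex b),
          ¬ SignedVoter.RegionHasUnsatisfiedCycle (SignedVoter.pairedTree b L)
            (SignedVoter.pairedSign b L) W ∧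
          ∃ x, 0 < SignedVoter.stayProb (SignedVoter.pairedTree b L) x W := by
    intro b L h
    let _ : (SignedVoter.pairedTree b L).LocallyFinite := fun x =>
      (SignedVoter.finite_neighborSet_pairedTree h.even x).fintype
    refine ⟨inferInstance, SignedVoter.pairedTree_connected b L, h.hasMultipleEquilibria, ?_⟩
    rintro ⟨W, hW, x, hx⟩
    exact hx.ne' (h.stayProb_eq_zero hW x)
  refine ⟨?_, main⟩
  obtain ⟨hfin, hG⟩ := main _ _ SignedVoter.isAdmissible_two_pow
  exact ⟨_, _, inferInstance, _, hfin, _, hG⟩
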